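/- Let $\varphi^N_0,\psi^N_j\in L_2(\mathbb R)$ and $\varphi^P_0,\psi^P_j\in L_2(\mathbb T)$ ($\mathbb T=\mathbb R/\mathbb Z$, $j=0,1,2,\dots$) be such that $$\{\varphi^N_0(\cdot-k),\ \psi^N_j(\cdot-2^{-j}k):\ j\ge 0,\ k\in\mathbb Z\}\quad\text{and}\quad \{\varphi^P_0,\ \psi^P_j(\cdot-2^{-j}k):\ j\ge 0,\ k=0,\dots,2^j-1\}$$ are Parseval frames for $L_2(\mathbb R)$ and $L_2(\mathbb T)$ respectively, and let $\psi^P_j(x)=\sum_{n\in\mathbb Z}\psi^N_j(x-n)$ for almost every $x$ and all $j$. Assume that every $\psi^N_j$ is locally absolutely continuous, put $\psi_j(x)=2^{-j/2}\psi^N_j(2^{-j}x)$, and suppose that there are $\varepsilon>0$ and functions $f,f_1\in L_2(\mathbb R)$, $f$ locally absolutely continuous, such that for all $j$ $$|\psi_j(x)|\le f(x)\ \text{ for all } x,\qquad |\psi_j'(x)|\le f_1(x)\ \text{ for almost every } x,$$ $$f(x)=O(|x|^{-3/2-\varepsilon}),\qquad f_1(x)=O(|x|^{-1-\varepsilon})\qquad\text{as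 } |x|\to\infty .$$ Uncertainty constants (with values in $[0,\infty]$). For $g\in L_2(\mathbb R)$, $g\neq0$, let $UC_H(g)=\Delta(g)\,\Delta(\widehat g)$, where $\Delta^2(g)=\|g\|^{-2}\int_{\mathbb R}(x-c(g))^2|g(x)|^2dx$, $c(g)=\|g\|^{-2}\int_{\mathbb R}x|g(x)|^2dx$, and $\widehat g(\omega)=(2\pi)^{-1/2}\int_{\mathbb R}g(x)e^{-i\omega x}dx$ (so that $UC_H\ge 1/2$). For $g\in L_2(\mathbb T)$, $g\ne 0$, with Fourier coefficients $c_k=\int_0^1 g(x)e^{-2\pi i kx}dx$ let $UC_B(g)=\sqrt{\mathrm{var}_A\,\mathrm{var}_F}$, where $$\mathrm{var}_A=\frac{\left(\sum_k|c_k|^2\right)^2}{\left|\sum_k c_{k-1}\overline{c_k}\right|^2}-1,\qquad \mathrm{var}_F=\frac{\sum_k k^2|c_k|^2}{\sum_k|c_k|^2}-\frac{\left(\sum_k k|c_k|^2\right)^2}{\left(\sum_k|c_k|^2\right)^2}.$$ Then $$\lim_{j\to\infty}UC_B(\psi^P_j)=\lim_{j\to\infty}UC_H(\psi^N_j)$$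 in the following sense. 1. If both limits exist in $[0,\infty]$, then they are equal. 2. Whether or not the limits are known to exist, if the norms do not degenerate, that is $\liminf_{j\to\infty}\|\psi^N_j\|_{L_2(\mathbb R)}>0$, then $UC_B(\psi^P_j)$ and $UC_H(\psi^N_j)$ are finite for all large $j$, $UC_B(\psi^P_j)-UC_H(\psi^N_j)\to0$, and for every $L\in[0,\infty]$ one has $UC_B(\psi^P_j)\to L$ if and only if $UC_H(\psi^N_j)\to L$; in particular one limit exists if and only if the other does. The condition $\liminf_{j\to\infty}\|\psi^N_j\|>0$ is not needed for the first assertion. (The values assigned to $UC_B$ and $UC_H$ at the zero function play no role.) -/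

import Mathlib

open MeasureTheory Filter Topology
open scoped ENNReal FourierTransform

noncomputable section

/-- A family `v` in a Hilbert space is a Parseval frame if
`∑ i, |(x, v i)|² = ‖x‖²` for every vector `x`. -/
def IsParsevalFrame {ι H : Type*} [NormedAddCommGroup H] [InnerProductSpace ℂ H]
    (v : ι → H) : Prop :=
  ∀ x : H, HasSum (fun i => ‖inner ℂ (v i) x‖ ^ 2) (‖x‖ ^ 2)

/-- The functions `v i` are square integrable and form a Parseval frame for `L²(μ)`. -/
def IsParsevalFrameOfFunctions {ι X : Type*} [MeasurableSpace X] (μ : Measure X)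
    (v : ι → X → ℂ) : Prop :=
  ∃ h : ∀ i, MemLp (v i) 2 μ, IsParsevalFrame (fun i => (h i).toLp (v i))

/-- The system of the functions `φ (x - k)`, `k ∈ ℤ`, and `ψ j (x - 2⁻ʲ k)`, `j ∈ ℕ`, `k ∈ ℤ`,
on the real line. -/
def nonstationarySystem (φ : ℝ → ℂ) (ψ : ℕ → ℝ → ℂ) : ℤ ⊕ (ℕ × ℤ) → ℝ → ℂ
  | Sum.inl k => fun x => φ (x - k)
  | Sum.inr (j, k) => fun x => ψ j (x - k / 2 ^ j)

/-- The system of the functions `φ` and `ψ j (x - 2⁻ʲ k)`, `j ∈ ℕ`, `k = 0, …, 2ʲ - 1`,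
on the circle `ℝ / ℤ`. -/
def periodicSystem (φ : UnitAddCircle → ℂ) (ψ : ℕ → UnitAddCircle → ℂ) :
    Unit ⊕ (Σ j : ℕ, Fin (2 ^ j)) → UnitAddCircle → ℂ
  | Sum.inl _ => φ
  | Sum.inr ⟨j, k⟩ => fun x => ψ j (x - (((k : ℕ) / 2 ^ j : ℝ) : UnitAddCircle))

/-- The centre `c(g) = ‖g‖⁻² ∫ x |g(x)|² dx`. -/
def centre (g : ℝ → ℂ) : ℝ :=
  (∫ x, x * ‖g x‖ ^ 2) / ∫ x, ‖g x‖ ^ 2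

/-- The variance `Δ²(g) = ‖g‖⁻² ∫ (x - c(g))² |g(x)|² dx`, possibly `∞`. For square integrable
`g` the integral is infinite, whatever the value of `centre g`, when `x² |g(x)|²` is not
integrable. -/
def spreadSq (g : ℝ → ℂ) : ℝ≥0∞ :=
  (∫⁻ x, ENNReal.ofReal ((x - centre g) ^ 2 * ‖g x‖ ^ 2)) / ∫⁻ x, ENNReal.ofReal (‖g x‖ ^ 2)

/-- The unitary Fourier transform in the angular frequency: for integrable `g`,
`ω ↦ (2π)^(-1/2) ∫ g(x) exp(-i ω x) dx`. It is obtained from the `L²` Fourier transform `𝓕`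
with the kernel `exp(-2π i ξ x)` by the dilation `ξ = ω / (2π)`. -/
def angularFourier (g : Lp ℂ 2 (volume : Measure ℝ)) : ℝ → ℂ :=
  fun ω => (((2 * Real.pi) ^ (-(1 / 2) : ℝ) : ℝ) : ℂ) *
    (𝓕 g : Lp ℂ 2 (volume : Measure ℝ)) (ω / (2 * Real.pi))

/-- The Heisenberg uncertainty constant `Δ(g) Δ(ĝ)`, normalized (by the use of the angular
frequency) so that its lower bound on nonzero functions is `1/2`. -/
def heisenbergUC (g : ℝ → ℂ) (hg : MemLp g 2 volume) : ℝ≥0∞ :=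
  spreadSq g ^ (1 / 2 : ℝ) * spreadSq (angularFourier (hg.toLp g)) ^ (1 / 2 : ℝ)

/-- `∑ |c k|²`. -/
def coeffNormSq (c : ℤ → ℂ) : ℝ := ∑' k, ‖c k‖ ^ 2

/-- The first trigonometric moment `∑ c (k-1) * conj (c k)`. -/
def trigMoment (c : ℤ → ℂ) : ℂ := ∑' k, c (k - 1) * (starRingEnd ℂ) (c k)

/-- The angular variance `‖c‖⁴ / |τ|² - 1`; it is `∞` if `τ = 0` and `c ≠ 0`. -/
def angularVariance (c : ℤ → ℂ) : ℝ≥0∞ :=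
  ENNReal.ofReal (coeffNormSq c ^ 2) / ENNReal.ofReal (‖trigMoment c‖ ^ 2) - 1

/-- The frequency variance `‖c‖⁻² ∑ k² |c k|² - ‖c‖⁻⁴ (∑ k |c k|²)²`, possibly `∞`. -/
def frequencyVariance (c : ℤ → ℂ) : ℝ≥0∞ :=
  (∑' k : ℤ, ENNReal.ofReal ((k : ℝ) ^ 2 * ‖c k‖ ^ 2)) / ENNReal.ofReal (coeffNormSq c) -
    ENNReal.ofReal ((∑' k : ℤ, (k : ℝ) * ‖c k‖ ^ 2) ^ 2 / coeffNormSq c ^ 2)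

/-- The Breitenberger uncertainty constant of a `1`-periodic function, computed from its
Fourier coefficients. -/
def breitenbergerUC (g : UnitAddCircle → ℂ) : ℝ≥0∞ :=
  (angularVariance (fourierCoeff g) * frequencyVariance (fourierCoeff g)) ^ (1 / 2 : ℝ)

/-- The rescaled function `x ↦ 2^(-j/2) g(2^(-j) x)`. -/
def rescale (j : ℕ) (g : ℝ → ℂ) : ℝ → ℂ :=
  fun x => (((2 : ℝ) ^ (-(j : ℝ) / 2) : ℝ) : ℂ) * g (x / 2 ^ j)

/-- `g` is absolutely continuous on every bounded interval. -/
def LocallyAC {E : Type*} [PseudoMetricSpace E] (g : ℝ → E) : Prop :=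
  ∀ a b : ℝ, AbsolutelyContinuousOnInterval g a b

end

/-! Up to a scalar correction, the squares of both constants are one expression, `uncertainty a x
d`, in the norms of three vectors of L²(ℝ) and the inner products of the first with the other two.
On the line the vectors are u = ψ_j^N, 2πi·2^j·x·u and 2^(-j)·u', Plancherel turning the spread of
the transform of u into a statement on u'. On the circle they are the restrictions to one period of
p, 2^j·(e^{2πix} - 1)·p and 2^(-j)·q, where p and q periodize u and u'; Parseval translates the
Fourier sums, and UC_B² is `uncertainty` divided by 1 - R·4^(-j), with R formed from the first two
vectors (`breitenbergerUC_eq_dilated`). The factors 2^j and 2^(-j) cancel but keep all vectors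
bounded.

In the dilated variable y = 2^j·x everything is dominated by fixed functions, 2^j·(e^{2πiy/2^j} - 1)
tends to 2πiy, and the periodization tails vanish, so corresponding vectors differ by o(1)
(`tendsto_toL2_periodize`). The functions themselves need not converge: along an ultrafilter the
bounded norms and inner products do, and if ‖u‖ stays away from zero the two constants acquire the
same finite limit (`exists_common_limit`). Testing all ultrafilters finer than `atTop` yields the
second assertion.

For the first assertion a single ultrafilter with nondegenerate norms is enough
(`exists_frequently_le_norm`). Were the norms to tend to zero, the frame identity on the circle for
e^{2πi·2^m·x} would read Σ_j 2^j·|û_j(2^m)|² = 1 - |c_{2^m}(φ^P)|², whose right side tends to 1 as m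
grows. The left side would tend to 0: domination upgrades L² decay to L¹ decay of the rescaled
functions, which makes the terms small uniformly in the frequency, while decay and Hölder regularity
of the transforms on the scale 2^j control the sum over j (`tendsto_tsum_sq_dyadic`). -/

/-! ### Locally absolutely continuous functions -/

theorem LocallyAC.continuous {E : Type*} [SeminormedAddCommGroup E] {g : ℝ → E} (hg : LocallyAC g) :
    Continuous g := by
  rw [continuous_iff_continuousAt]
  intro x
  have h : Set.uIcc (x - 1) (x + 1) ∈ 𝓝 x := by
    rw [Set.uIcc_of_le (by linarith)]
    exact Icc_mem_nhds (by linarith) (by linarith)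
  exact (hg (x - 1) (x + 1)).continuousOn.continuousAt h

/-- Applied to real and imaginary parts, this reduces complex functions to the real theory of
absolute continuity. -/
theorem LocallyAC.comp_lipschitz {E F : Type*} [PseudoMetricSpace E] [PseudoMetricSpace F]
    {g : ℝ → E} (hg : LocallyAC g) {L : E → F} {K : NNReal} (hL : LipschitzWith K L) :
    LocallyAC fun x => L (g x) := by
  intro a b
  have h := hg a b
  refine squeeze_zero (fun t => Finset.sum_nonneg fun i _ => dist_nonneg) (fun t => ?_)
    (by simpa using Tendsto.const_mul (K : ℝ) h)
  rw [Finset.mul_sum]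
  gcongr
  exact hL.dist_le_mul _ _

theorem LocallyAC.ae_differentiableAt_real {g : ℝ → ℝ} (hg : LocallyAC g) :
    ∀ᵐ x, DifferentiableAt ℝ g x := by
  have h : ∀ n : ℕ, ∀ᵐ x : ℝ, x ∈ Set.uIcc (-(n : ℝ)) n → DifferentiableAt ℝ g x :=
    fun n => (hg _ _).ae_differentiableAt
  filter_upwards [ae_all_iff.2 h] with x hx
  obtain ⟨n, hn⟩ := exists_nat_ge |x|
  refine hx n ?_
  rw [Set.uIcc_of_le (by linarith [abs_nonneg x])]
  exact abs_le.1 hn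

theorem LocallyAC.ae_differentiableAt {g : ℝ → ℂ} (hg : LocallyAC g) :
    ∀ᵐ x, DifferentiableAt ℝ g x := by
  have h1 := (hg.comp_lipschitz (L := Complex.re)
    Complex.reCLM.lipschitz).ae_differentiableAt_real
  have h2 := (hg.comp_lipschitz (L := Complex.im)
    Complex.imCLM.lipschitz).ae_differentiableAt_real
  filter_upwards [h1, h2] with x h1 h2
  have h := (Complex.ofRealCLM.differentiableAt.comp x h1).add
    ((Complex.ofRealCLM.differentiableAt.comp x h2).mul_const Complex.I)
  refine h.congr_of_eventuallyEq (Eventually.of_forall fun y => ?_)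
  simp [Complex.re_add_im]

theorem LocallyAC.integral_deriv {g : ℝ → ℂ} (hg : LocallyAC g) (a b : ℝ)
    (hi : IntervalIntegrable (deriv g) volume a b) :
    ∫ x in a..b, deriv g x = g b - g a := by
  have hd := hg.ae_differentiableAt
  have h1 := ((hg.comp_lipschitz (L := Complex.re) Complex.reCLM.lipschitz) a b).integral_deriv_eq_sub
  have h2 := ((hg.comp_lipschitz (L := Complex.im) Complex.imCLM.lipschitz) a b).integral_deriv_eq_sub
  have e1 : ∫ x in a..b, Complex.reCLM (deriv g x) = (g b).re - (g a).re := by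
    rw [← h1]
    refine intervalIntegral.integral_congr_ae ?_
    filter_upwards [hd] with x hx _
    exact (Complex.reCLM.hasFDerivAt.comp_hasDerivAt x hx.hasDerivAt).deriv.symm
  have e2 : ∫ x in a..b, Complex.imCLM (deriv g x) = (g b).im - (g a).im := by
    rw [← h2]
    refine intervalIntegral.integral_congr_ae ?_
    filter_upwards [hd] with x hx _
    exact (Complex.imCLM.hasFDerivAt.comp_hasDerivAt x hx.hasDerivAt).deriv.symm
  rw [ContinuousLinearMap.intervalIntegral_comp_comm _ hi] at e1 e2
  apply Complex.ext
  · simpa using e1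
  · simpa using e2

theorem ContDiff.locallyAC {g : ℝ → ℂ} (hg : ContDiff ℝ 1 g) : LocallyAC g :=
  fun _ _ => hg.contDiffOn.absolutelyContinuousOnInterval

/-! ### Fourier transforms of derivatives and of integrable L² functions -/

theorem integral_deriv_eq_zero_of_locallyAC {g : ℝ → ℂ} (hg : LocallyAC g)
    (hi : Integrable (deriv g)) (h0 : Tendsto g (cocompact ℝ) (𝓝 0)) : ∫ x, deriv g x = 0 := by
  have h := intervalIntegral_tendsto_integral (a := fun x : ℝ => -x) (b := fun x : ℝ => x)
    hi tendsto_neg_atTop_atBot tendsto_id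
  simp_rw [fun x : ℝ => hg.integral_deriv (-x) x hi.intervalIntegrable] at h
  refine tendsto_nhds_unique h ?_
  have h1 := h0.mono_left atTop_le_cocompact
  have h2 := (h0.mono_left atBot_le_cocompact).comp tendsto_neg_atTop_atBot
  simpa using h1.sub h2

/-- The derivative of a locally absolutely continuous function is transformed to multiplication
by `2πiξ`. -/
theorem fourier_deriv_of_locallyAC {u : ℝ → ℂ} (hu : LocallyAC u) (hi : Integrable u)
    (hi' : Integrable (deriv u)) (h0 : Tendsto u (cocompact ℝ) (𝓝 0)) (ξ : ℝ) :
    𝓕 (deriv u) ξ = 2 * Real.pi * Complex.I * ξ * 𝓕 u ξ := by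
  set e : ℝ → ℂ := fun x => Complex.exp (((-2 * Real.pi * x * ξ : ℝ) : ℂ) * Complex.I) with he
  have hde : ∀ x, HasDerivAt e (e x * (-2 * Real.pi * Complex.I * ξ)) x := by
    intro x
    have h1 : HasDerivAt (fun x : ℝ => ((-2 * Real.pi * x * ξ : ℝ) : ℂ) * Complex.I)
        (-2 * Real.pi * Complex.I * ξ) x := by
      have h2 : HasDerivAt (fun x : ℝ => -2 * Real.pi * x * ξ) (-2 * Real.pi * ξ) x := by
        simpa using ((hasDerivAt_id x).const_mul (-2 * Real.pi)).mul_const ξ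
      have h3 := h2.ofReal_comp.mul_const Complex.I
      refine h3.congr_deriv ?_
      push_cast
      ring
    exact h1.cexp
  have hne : ∀ x, ‖e x‖ = 1 := fun x => Complex.norm_exp_ofReal_mul_I _
  have hec : Continuous e := by fun_prop
  have hemul : ∀ {v : ℝ → ℂ}, Integrable v → Integrable fun x => e x * v x := by
    intro v hv
    refine hv.bdd_mul (c := 1) hec.aestronglyMeasurable (Eventually.of_forall fun x => (hne x).le)
  have hcd : ContDiff ℝ 1 fun x : ℝ => -2 * Real.pi * x * ξ := by fun_prop
  have heAC : LocallyAC e := ContDiff.locallyAC <| Complex.contDiff_exp.comp <|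
    (Complex.ofRealCLM.contDiff.comp hcd).mul contDiff_const
  have hv : LocallyAC fun x => e x * u x := fun a b => (heAC a b).fun_smul (hu a b)
  have hdv : deriv (fun x => e x * u x) =ᵐ[volume]
      fun x => e x * deriv u x + (-2 * Real.pi * Complex.I * ξ) * (e x * u x) := by
    filter_upwards [hu.ae_differentiableAt] with x hx
    rw [((hde x).fun_mul hx.hasDerivAt).deriv]
    ring
  have hint := (hemul hi').add ((hemul hi).const_mul (-2 * Real.pi * Complex.I * ξ))
  have h := integral_deriv_eq_zero_of_locallyAC hv (hint.congr hdv.symm) (by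
    rw [tendsto_zero_iff_norm_tendsto_zero] at h0 ⊢
    simpa [hne] using h0)
  rw [integral_congr_ae hdv, integral_add (hemul hi') ((hemul hi).const_mul _),
    integral_const_mul] at h
  simp only [Real.fourier_real_eq_integral_exp_smul, smul_eq_mul]
  change ∫ x, e x * deriv u x = _ * ∫ x, e x * u x
  linear_combination h

/-- The `L²` Fourier transform of an integrable function is given by the integral. -/
theorem fourier_toLp_ae_eq {u : ℝ → ℂ} (h1 : Integrable u) (h2 : MemLp u 2 volume) :
    ((𝓕 (h2.toLp u) : Lp ℂ 2 (volume : Measure ℝ)) : ℝ → ℂ) =ᵐ[volume] 𝓕 u := by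
  have hc : Continuous (𝓕 u) :=
    VectorFourier.fourierIntegral_continuous Real.continuous_fourierChar (by fun_prop) h1
  refine ae_eq_of_integral_contDiff_smul_eq
    ((Lp.memLp (𝓕 (h2.toLp u))).locallyIntegrable (by norm_num)) hc.locallyIntegrable ?_
  intro g hg hgs
  have hg' : ContDiff ℝ (⊤ : ℕ∞) fun x => (g x : ℂ) := Complex.ofRealCLM.contDiff.comp hg
  have hgs' : HasCompactSupport fun x => (g x : ℂ) := hgs.comp_left (g := ((↑) : ℝ → ℂ)) rfl
  -- The L² transform agrees with the distributional one, so against a test function it moves onto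
  -- that function; the integral transform does the same by Fubini.
  have h := congrArg (fun T => T (hgs'.toSchwartzMap hg'))
    (Lp.fourier_toTemperedDistribution_eq (h2.toLp u))
  simp only [TemperedDistribution.fourier_apply, Lp.toTemperedDistribution_apply] at h
  have e1 : ∀ x, (g x) • ((𝓕 (h2.toLp u) : Lp ℂ 2 (volume : Measure ℝ)) : ℝ → ℂ) x =
    (hgs'.toSchwartzMap hg') x • ((𝓕 (h2.toLp u) : Lp ℂ 2 (volume : Measure ℝ)) : ℝ → ℂ) x := by
    intro x; simp
  simp_rw [e1]
  rw [← h]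
  have hgi : Integrable fun x => (g x : ℂ) := (hg'.continuous.integrable_of_hasCompactSupport hgs')
  have h3 := VectorFourier.integral_fourierIntegral_smul_eq_flip (L := innerₗ ℝ)
    (μ := volume) (ν := volume) Real.continuous_fourierChar (by fun_prop) hgi h1
  calc _ = ∫ x, (𝓕 (fun x => (g x : ℂ)) x) • u x := by
        refine integral_congr_ae ?_
        filter_upwards [h2.coeFn_toLp] with x hx
        rw [hx, SchwartzMap.fourier_coe]
        rfl
    _ = ∫ x, (g x : ℂ) • 𝓕 u x := by
        refine Eq.trans h3 ?_
        rw [flip_innerₗ]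
        rfl
    _ = _ := by simp

/-! ### Norms and inner products of L² classes -/

section SquareIntegrable

variable {α : Type*} [MeasurableSpace α] {μ : Measure α} {f g : α → ℂ}

theorem inner_toLp_toLp (hf : MemLp f 2 μ) (hg : MemLp g 2 μ) :
    inner ℂ (hf.toLp f) (hg.toLp g) = ∫ x, g x * (starRingEnd ℂ) (f x) ∂μ := by
  rw [L2.inner_def]
  refine integral_congr_ae ?_
  filter_upwards [hf.coeFn_toLp, hg.coeFn_toLp] with x h1 h2
  rw [h1, h2, RCLike.inner_apply]

theorem norm_toLp_sq (hf : MemLp f 2 μ) : ‖hf.toLp f‖ ^ 2 = ∫ x, ‖f x‖ ^ 2 ∂μ := by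
  have h := inner_toLp_toLp hf hf
  rw [inner_self_eq_norm_sq_to_K] at h
  have h2 : ∀ x, f x * (starRingEnd ℂ) (f x) = ((‖f x‖ ^ 2 : ℝ) : ℂ) := fun x => by
    rw [RCLike.mul_conj]; norm_cast
  simp_rw [h2] at h
  rw [integral_complex_ofReal] at h
  refine Complex.ofReal_injective (Eq.trans ?_ h)
  push_cast
  rfl

theorem norm_toLp_le_of_integral_sq_le {C : ℝ} (hf : MemLp f 2 μ) (hC : 0 ≤ C)
    (h : ∫ x, ‖f x‖ ^ 2 ∂μ ≤ C ^ 2) : ‖hf.toLp f‖ ≤ C := by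
  rw [← norm_toLp_sq hf] at h
  exact (sq_le_sq₀ (norm_nonneg _) hC).1 h

theorem norm_toLp_le_of_norm_le {w : α → ℝ} (hf : MemLp f 2 μ)
    (hw : Integrable (fun x => w x ^ 2) μ) (h : ∀ᵐ x ∂μ, ‖f x‖ ≤ w x) :
    ‖hf.toLp f‖ ≤ √(∫ x, w x ^ 2 ∂μ) := by
  refine norm_toLp_le_of_integral_sq_le hf (Real.sqrt_nonneg _) ?_
  rw [Real.sq_sqrt (integral_nonneg fun x => sq_nonneg _)]
  refine integral_mono_ae hf.norm.integrable_sq hw ?_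
  filter_upwards [h] with x hx
  gcongr

end SquareIntegrable

/-! ### The Heisenberg constant as a Hilbert space expression -/

/-- The product of the variances of `x` and `d` with respect to `a`, divided by `4π²`. -/
noncomputable def uncertainty {H : Type*} [NormedAddCommGroup H] [InnerProductSpace ℂ H] (a x d : H) : ℝ :=
  ((‖a‖ ^ 2 * ‖x‖ ^ 2 - ‖inner ℂ a x‖ ^ 2) / ‖a‖ ^ 4) *
    ((‖a‖ ^ 2 * ‖d‖ ^ 2 - ‖inner ℂ a d‖ ^ 2) / ‖a‖ ^ 4) / (2 * Real.pi) ^ 2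

theorem gram_nonneg {H : Type*} [NormedAddCommGroup H] [InnerProductSpace ℂ H] (a x : H) :
    0 ≤ ‖a‖ ^ 2 * ‖x‖ ^ 2 - ‖inner ℂ a x‖ ^ 2 := by
  have h := norm_inner_le_norm (𝕜 := ℂ) a x
  have h2 : ‖inner ℂ a x‖ ^ 2 ≤ (‖a‖ * ‖x‖) ^ 2 := by gcongr
  rw [mul_pow] at h2
  linarith

theorem spreadSq_eq {v : ℝ → ℂ} (hv : Integrable fun x => ‖v x‖ ^ 2)
    (hv2 : Integrable fun x => x ^ 2 * ‖v x‖ ^ 2) (h0 : 0 < ∫ x, ‖v x‖ ^ 2) :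
    spreadSq v = ENNReal.ofReal
      ((∫ x, x ^ 2 * ‖v x‖ ^ 2) / (∫ x, ‖v x‖ ^ 2) -
        (∫ x, x * ‖v x‖ ^ 2) ^ 2 / (∫ x, ‖v x‖ ^ 2) ^ 2) := by
  have hv1 : Integrable fun x => x * ‖v x‖ ^ 2 := by
    refine (hv.add hv2).mono' (by
      exact (continuous_id.aestronglyMeasurable.mul hv.aestronglyMeasurable)) ?_
    refine Eventually.of_forall fun x => ?_
    simp only [norm_mul, norm_pow, Real.norm_eq_abs, abs_norm, Pi.add_apply]
    have : |x| ≤ 1 + x ^ 2 := by nlinarith [sq_abs x, sq_nonneg (|x| - 1), abs_nonneg x]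
    nlinarith [sq_nonneg ‖v x‖]
  set c := centre v with hc
  have hexp : (fun x => (x - c) ^ 2 * ‖v x‖ ^ 2) =
      fun x => (x ^ 2 * ‖v x‖ ^ 2 - 2 * c * (x * ‖v x‖ ^ 2)) + c ^ 2 * ‖v x‖ ^ 2 := by
    funext x; ring
  have hi1 : Integrable fun x => x ^ 2 * ‖v x‖ ^ 2 - 2 * c * (x * ‖v x‖ ^ 2) :=
    hv2.sub (hv1.const_mul (2 * c))
  have hi : Integrable fun x => (x - c) ^ 2 * ‖v x‖ ^ 2 := by
    rw [hexp]; exact hi1.add (hv.const_mul _)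
  have hI : ∫ x, (x - c) ^ 2 * ‖v x‖ ^ 2 =
      (∫ x, x ^ 2 * ‖v x‖ ^ 2) - 2 * c * (∫ x, x * ‖v x‖ ^ 2) + c ^ 2 * ∫ x, ‖v x‖ ^ 2 := by
    rw [hexp, integral_add hi1 (hv.const_mul _), integral_sub hv2 (hv1.const_mul _),
      integral_const_mul, integral_const_mul]
  unfold spreadSq
  rw [← ofReal_integral_eq_lintegral_ofReal hi (Eventually.of_forall fun x => by positivity),
    ← ofReal_integral_eq_lintegral_ofReal hv (Eventually.of_forall fun x => by positivity),
    ← ENNReal.ofReal_div_of_pos h0, hI, hc, centre]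
  congr 1
  field_simp
  ring

section Heisenberg

variable {u : ℝ → ℂ}

/-- The multiplier 2πix, rather than x, is used because it is the limit of the circle multiplier
L·(e^{2πix/L} - 1). -/
theorem spreadSq_eq_toLp (hu : MemLp u 2 volume)
    (hx : MemLp (fun x : ℝ => 2 * Real.pi * Complex.I * x * u x) 2 volume)
    (h0 : hu.toLp u ≠ 0) :
    spreadSq u = ENNReal.ofReal ((‖hu.toLp u‖ ^ 2 * ‖hx.toLp _‖ ^ 2 -
      ‖inner ℂ (hu.toLp u) (hx.toLp _)‖ ^ 2) / ‖hu.toLp u‖ ^ 4 / (2 * Real.pi) ^ 2) := by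
  have hn : 0 < ‖hu.toLp u‖ := norm_pos_iff.2 h0
  have e0 := norm_toLp_sq hu
  have e2 : ‖hx.toLp _‖ ^ 2 = (2 * Real.pi) ^ 2 * ∫ x, x ^ 2 * ‖u x‖ ^ 2 := by
    rw [norm_toLp_sq hx, ← integral_const_mul]
    refine integral_congr_ae (Eventually.of_forall fun x => ?_)
    simp only [norm_mul, Complex.norm_ofNat, Complex.norm_real, Complex.norm_I, Real.norm_eq_abs,
      abs_of_pos Real.pi_pos, mul_pow, sq_abs]
    ring
  have e1 : ‖inner ℂ (hu.toLp u) (hx.toLp _)‖ ^ 2 =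
      (2 * Real.pi) ^ 2 * (∫ x, x * ‖u x‖ ^ 2) ^ 2 := by
    have h : ∀ x : ℝ, 2 * Real.pi * Complex.I * x * u x * (starRingEnd ℂ) (u x) =
        2 * Real.pi * Complex.I * ((x * ‖u x‖ ^ 2 : ℝ) : ℂ) := fun x => by
      rw [mul_assoc, RCLike.mul_conj]; push_cast; ring_nf; rfl
    rw [inner_toLp_toLp hu hx]
    simp_rw [h]
    rw [integral_const_mul, integral_complex_ofReal]
    simp [mul_pow]
  have hi2 : Integrable fun x => x ^ 2 * ‖u x‖ ^ 2 := by
    refine (hx.norm.integrable_sq.const_mul ((2 * Real.pi) ^ 2)⁻¹).congr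
      (Eventually.of_forall fun x => ?_)
    simp only [norm_mul, Complex.norm_ofNat, Complex.norm_real, Complex.norm_I, Real.norm_eq_abs,
      abs_of_pos Real.pi_pos, mul_pow, sq_abs]
    have := Real.pi_pos.ne'
    field_simp
  rw [spreadSq_eq hu.norm.integrable_sq hi2 (by rw [← e0]; positivity), e1, e2, ← e0]
  congr 1
  have := Real.pi_pos
  field_simp

/-- The transform of u' is 2πiξ times that of u, so Plancherel turns frequency moments into ‖u'‖²
and ⟨u, u'⟩. The dilation ω = 2πξ absorbs the factor 2π. -/
theorem spreadSq_angularFourier (hu : MemLp u 2 volume) (hAC : LocallyAC u)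
    (hi : Integrable u) (hi' : Integrable (deriv u)) (hd : MemLp (deriv u) 2 volume)
    (hlim : Tendsto u (cocompact ℝ) (𝓝 0)) (h0 : hu.toLp u ≠ 0) :
    spreadSq (angularFourier (hu.toLp u)) = ENNReal.ofReal ((‖hu.toLp u‖ ^ 2 * ‖hd.toLp _‖ ^ 2 -
      ‖inner ℂ (hu.toLp u) (hd.toLp _)‖ ^ 2) / ‖hu.toLp u‖ ^ 4) := by
  have hpi := Real.pi_pos
  have hn : 0 < ‖hu.toLp u‖ := norm_pos_iff.2 h0
  set F : Lp ℂ 2 (volume : Measure ℝ) := 𝓕 (hu.toLp u) with hF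
  set G : Lp ℂ 2 (volume : Measure ℝ) := 𝓕 (hd.toLp (deriv u)) with hG
  have hGF : (G : ℝ → ℂ) =ᵐ[volume] fun ξ => 2 * Real.pi * Complex.I * ξ * F ξ := by
    filter_upwards [fourier_toLp_ae_eq hi hu, fourier_toLp_ae_eq hi' hd] with ξ h1 h2
    rw [hG, hF, h1, h2, fourier_deriv_of_locallyAC hAC hi hi' hlim]
  have hFm := Lp.memLp F
  have hGm := Lp.memLp G
  have eF : hFm.toLp F = F := Lp.toLp_coeFn F hFm
  have eG : hGm.toLp G = G := Lp.toLp_coeFn G hGm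
  have nF : ‖hu.toLp u‖ ^ 2 = ∫ ξ, ‖F ξ‖ ^ 2 := by
    rw [← norm_toLp_sq hFm, eF, hF, Lp.norm_fourier_eq]
  have hξF : Integrable fun ξ => ξ ^ 2 * ‖F ξ‖ ^ 2 := by
    refine (hGm.norm.integrable_sq.const_mul ((2 * Real.pi) ^ 2)⁻¹).congr ?_
    filter_upwards [hGF] with ξ h
    simp only [h, norm_mul, Complex.norm_ofNat, Complex.norm_real, Complex.norm_I,
      Real.norm_eq_abs, abs_of_pos hpi, mul_pow, sq_abs]
    field_simp
  have nG : ‖hd.toLp (deriv u)‖ ^ 2 = (2 * Real.pi) ^ 2 * ∫ ξ, ξ ^ 2 * ‖F ξ‖ ^ 2 := by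
    rw [← Lp.norm_fourier_eq, ← hG, ← eG, norm_toLp_sq hGm, ← integral_const_mul]
    refine integral_congr_ae ?_
    filter_upwards [hGF] with ξ h
    simp only [h, norm_mul, Complex.norm_ofNat, Complex.norm_real, Complex.norm_I,
      Real.norm_eq_abs, abs_of_pos hpi, mul_pow, sq_abs]
    ring
  have nFG : ‖inner ℂ (hu.toLp u) (hd.toLp (deriv u))‖ ^ 2 =
      (2 * Real.pi) ^ 2 * (∫ ξ, ξ * ‖F ξ‖ ^ 2) ^ 2 := by
    have h : (fun ξ => G ξ * (starRingEnd ℂ) (F ξ)) =ᵐ[volume]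
        fun ξ => 2 * Real.pi * Complex.I * ((ξ * ‖F ξ‖ ^ 2 : ℝ) : ℂ) := by
      filter_upwards [hGF] with ξ h
      rw [h, mul_assoc, RCLike.mul_conj]; push_cast; ring_nf; rfl
    have hin := inner_toLp_toLp hFm hGm
    rw [eF, eG] at hin
    rw [← Lp.inner_fourier_eq, ← hG, ← hF, hin, integral_congr_ae h, integral_const_mul, integral_complex_ofReal]
    simp [mul_pow]
  set κ : ℝ := (2 * Real.pi) ^ (-(1 / 2) : ℝ) with hκ
  have hκ2 : κ ^ 2 = (2 * Real.pi)⁻¹ := by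
    rw [hκ, ← Real.rpow_natCast, ← Real.rpow_mul (by positivity)]
    norm_num [Real.rpow_neg_one]
  have hκ0 : 0 < κ := by positivity
  have nv : ∀ ω, ‖angularFourier (hu.toLp u) ω‖ ^ 2 =
      (2 * Real.pi)⁻¹ * ‖F (ω / (2 * Real.pi))‖ ^ 2 := fun ω => by
    rw [angularFourier, ← hκ, ← hF, norm_mul, mul_pow, Complex.norm_real, Real.norm_eq_abs,
      sq_abs, hκ2]
  have i0 : ∫ ω, ‖angularFourier (hu.toLp u) ω‖ ^ 2 = ‖hu.toLp u‖ ^ 2 := by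
    simp_rw [nv]
    rw [integral_const_mul, Measure.integral_comp_div (fun ξ => ‖F ξ‖ ^ 2), ← nF,
      abs_of_pos (by positivity), smul_eq_mul]
    field_simp
  have i1 : ∫ ω, ω * ‖angularFourier (hu.toLp u) ω‖ ^ 2 =
      2 * Real.pi * ∫ ξ, ξ * ‖F ξ‖ ^ 2 := by
    have h : ∀ ω, ω * ‖angularFourier (hu.toLp u) ω‖ ^ 2 =
        (fun ξ => ξ * ‖F ξ‖ ^ 2) (ω / (2 * Real.pi)) := fun ω => by
      rw [nv]; field_simp
    simp_rw [h]
    rw [Measure.integral_comp_div (fun ξ => ξ * ‖F ξ‖ ^ 2), abs_of_pos (by positivity), smul_eq_mul]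
  have h2 : (fun ω => ω ^ 2 * ‖angularFourier (hu.toLp u) ω‖ ^ 2) =
      fun ω => 2 * Real.pi * (fun ξ => ξ ^ 2 * ‖F ξ‖ ^ 2) (ω / (2 * Real.pi)) := by
    funext ω; rw [nv]; field_simp
  have i2 : ∫ ω, ω ^ 2 * ‖angularFourier (hu.toLp u) ω‖ ^ 2 =
      (2 * Real.pi) ^ 2 * ∫ ξ, ξ ^ 2 * ‖F ξ‖ ^ 2 := by
    rw [h2, integral_const_mul, Measure.integral_comp_div (fun ξ => ξ ^ 2 * ‖F ξ‖ ^ 2),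
      abs_of_pos (by positivity), smul_eq_mul]
    ring
  rw [spreadSq_eq, i0, i1, i2, nFG, nG]
  · congr 1
    field_simp
  · simp_rw [nv]
    exact (hFm.norm.integrable_sq.comp_div (by positivity)).const_mul _
  · rw [h2]
    exact (hξF.comp_div (by positivity)).const_mul _
  · rw [i0]; positivity

theorem heisenbergUC_eq (hu : MemLp u 2 volume) (hAC : LocallyAC u)
    (hi : Integrable u) (hi' : Integrable (deriv u)) (hd : MemLp (deriv u) 2 volume)
    (hx : MemLp (fun x : ℝ => 2 * Real.pi * Complex.I * x * u x) 2 volume)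
    (hlim : Tendsto u (cocompact ℝ) (𝓝 0)) (h0 : hu.toLp u ≠ 0) :
    heisenbergUC u hu =
      ENNReal.ofReal (uncertainty (hu.toLp u) (hx.toLp _) (hd.toLp _)) ^ (1 / 2 : ℝ) := by
  rw [heisenbergUC, spreadSq_eq_toLp hu hx h0, spreadSq_angularFourier hu hAC hi hi' hd hlim h0,
    ← ENNReal.mul_rpow_of_nonneg _ _ (by norm_num), ← ENNReal.ofReal_mul, uncertainty]
  · congr 2
    ring
  · exact div_nonneg (div_nonneg (gram_nonneg _ _) (by positivity)) (by positivity)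

end Heisenberg

/-! ### Periodization and Fourier series on a period -/

/-- The fundamental domain `(-1/2, 1/2]` of `ℝ / ℤ`. -/
def centredPeriod : Set ℝ := Set.Ioc (-(1 / 2)) (1 / 2)

theorem measurableSet_centredPeriod : MeasurableSet centredPeriod := measurableSet_Ioc

theorem volume_centredPeriod : volume centredPeriod = 1 := by
  rw [centredPeriod, Real.volume_Ioc]; norm_num

theorem integral_centredPeriod {E : Type*} [NormedAddCommGroup E] [NormedSpace ℝ E] (f : ℝ → E) :
    ∫ x in centredPeriod, f x = ∫ x in (-(1 / 2))..(1 / 2), f x := by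
  rw [intervalIntegral.integral_of_le (by norm_num), centredPeriod]

/-- The `1`-periodization of a function on the line. -/
noncomputable def periodize (v : ℝ → ℂ) (x : ℝ) : ℂ := ∑' n : ℤ, v (x - n)

theorem hasSum_integral_centredPeriod {E : Type*} [NormedAddCommGroup E] [NormedSpace ℝ E]
    {w : ℝ → E} (hw : Integrable w) :
    HasSum (fun n : ℤ => ∫ x in centredPeriod, w (x - n)) (∫ x, w x) := by
  rw [← (Equiv.neg ℤ).hasSum_iff]
  refine (hw.hasSum_intervalIntegral (-(1 / 2))).congr_fun ?_
  intro n
  simp only [Function.comp_apply, Equiv.neg_apply, integral_centredPeriod, Int.cast_neg,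
    sub_neg_eq_add, intervalIntegral.integral_comp_add_right]
  congr 1
  ring

theorem exp_two_pi_int_periodic (x : ℝ) (n k : ℤ) :
    Complex.exp (((-2 * Real.pi * (x - n) * k : ℝ) : ℂ) * Complex.I) =
      Complex.exp (((-2 * Real.pi * x * k : ℝ) : ℂ) * Complex.I) := by
  rw [Complex.exp_eq_exp_iff_exists_int]
  refine ⟨n * k, ?_⟩
  push_cast
  ring

/-- Fourier coefficients are treated as values at integers of the transform of a truncated function,
so that circle and line functions can be compared in the same space L²(ℝ). -/
theorem fourier_indicator_eq (w : ℝ → ℂ) (k : ℝ) :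
    𝓕 (centredPeriod.indicator w) k =
      ∫ x in centredPeriod, Complex.exp (((-2 * Real.pi * x * k : ℝ) : ℂ) * Complex.I) * w x := by
  rw [Real.fourier_real_eq_integral_exp_smul, ← integral_indicator measurableSet_centredPeriod]
  refine integral_congr_ae (Eventually.of_forall fun x => ?_)
  by_cases h : x ∈ centredPeriod <;> simp [h]

/-- The character of integer frequency k is 1-periodic, hence the integral over the line unfolds
into the integral of the periodization over one period. -/
theorem fourier_periodize {v : ℝ → ℂ} (hv : Integrable v) (k : ℤ) :
    𝓕 (centredPeriod.indicator (periodize v)) k = 𝓕 v k := by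
  set e : ℝ → ℂ := fun x => Complex.exp (((-2 * Real.pi * x * k : ℝ) : ℂ) * Complex.I) with he
  have hne : ∀ x, ‖e x‖ = 1 := fun x => Complex.norm_exp_ofReal_mul_I _
  have hec : Continuous e := by fun_prop
  have hw : Integrable fun x => e x * v x :=
    hv.bdd_mul (c := 1) hec.aestronglyMeasurable (Eventually.of_forall fun x => (hne x).le)
  have h1 := (hasSum_integral_centredPeriod hw)
  have h2 := (hasSum_integral_centredPeriod hw.norm)
  have h3 := hasSum_integral_of_summable_integral_norm
    (μ := volume.restrict centredPeriod) (F := fun (n : ℤ) x => e (x - n) * v (x - n))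
    (fun n => (hw.comp_sub_right (n : ℝ)).integrableOn) h2.summable
  rw [fourier_indicator_eq, Real.fourier_real_eq_integral_exp_smul]
  refine Eq.trans ?_ (h3.unique h1)
  refine integral_congr_ae (Eventually.of_forall fun x => ?_)
  simp only [periodize, he, exp_two_pi_int_periodic, tsum_mul_left]

/-- Tonelli: the sum of the absolute values has integral ‖v‖₁ over a period, hence is finite almost
everywhere. -/
theorem ae_summable_periodize {v : ℝ → ℂ} (hv : Integrable v) :
    ∀ᵐ x ∂(volume.restrict centredPeriod), Summable fun n : ℤ => v (x - n) := by
  have h := hasSum_integral_centredPeriod hv.norm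
  have hm : ∀ n : ℤ, AEMeasurable (fun x => ‖v (x - n)‖ₑ) (volume.restrict centredPeriod) :=
    fun n => (hv.comp_sub_right (n : ℝ)).aestronglyMeasurable.restrict.enorm
  have hfin : ∫⁻ x in centredPeriod, ∑' n : ℤ, ‖v (x - n)‖ₑ ≠ ∞ := by
    rw [lintegral_tsum hm]
    have : ∀ n : ℤ, ∫⁻ x in centredPeriod, ‖v (x - n)‖ₑ =
        ENNReal.ofReal (∫ x in centredPeriod, ‖v (x - n)‖) := fun n => by
      rw [ofReal_integral_norm_eq_lintegral_enorm (hv.comp_sub_right (n : ℝ)).integrableOn]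
    simp_rw [this]
    rw [← ENNReal.ofReal_tsum_of_nonneg (fun n => integral_nonneg fun x => norm_nonneg _)
      h.summable]
    exact ENNReal.ofReal_ne_top
  filter_upwards [ae_lt_top' (AEMeasurable.tsum hm) hfin] with x hx
  exact Summable.of_nnnorm (ENNReal.tsum_coe_ne_top_iff_summable.1 hx.ne)

theorem aestronglyMeasurable_periodize {v : ℝ → ℂ} (hv : Integrable v) :
    AEStronglyMeasurable (periodize v) (volume.restrict centredPeriod) := by
  refine aestronglyMeasurable_of_tendsto_ae atTop
    (f := fun (s : Finset ℤ) x => ∑ n ∈ s, v (x - n)) (fun s => ?_) ?_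
  · exact Finset.aestronglyMeasurable_fun_sum s fun n _ =>
      (hv.comp_sub_right (n : ℝ)).aestronglyMeasurable.restrict
  · filter_upwards [ae_summable_periodize hv] with x hx
    exact hx.hasSum

theorem fourierCoeffOn_eq_fourier {F : ℝ → ℂ} (k : ℤ) :
    fourierCoeffOn (a := -(1 / 2)) (b := 1 / 2) (by norm_num) (centredPeriod.indicator F) k =
      𝓕 (centredPeriod.indicator F) k := by
  rw [fourierCoeffOn_eq_integral, ← integral_centredPeriod, fourier_indicator_eq]
  have h1 : (1 / (1 / 2 - -(1 / 2)) : ℝ) = 1 := by norm_num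
  rw [h1, one_smul]
  refine setIntegral_congr_fun measurableSet_centredPeriod fun x hx => ?_
  have h2 : ((1 / 2 - -(1 / 2) : ℝ) : ℂ) = 1 := by norm_num
  simp only [Set.indicator_of_mem hx, fourier_coe_apply, h2, smul_eq_mul]
  congr 2
  push_cast
  ring

theorem hasSum_norm_fourier_sq {F : ℝ → ℂ} (hF : MemLp (centredPeriod.indicator F) 2 volume) :
    HasSum (fun k : ℤ => ‖𝓕 (centredPeriod.indicator F) k‖ ^ 2) (‖hF.toLp _‖ ^ 2) := by
  have h := hasSum_sq_fourierCoeffOn (a := -(1 / 2)) (b := 1 / 2) (by norm_num)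
    (hF.mono_measure Measure.restrict_le_self)
  simp_rw [fourierCoeffOn_eq_fourier] at h
  convert h using 1
  rw [norm_toLp_sq, ← integral_centredPeriod, ← integral_indicator measurableSet_centredPeriod]
  norm_num
  refine integral_congr_ae (Eventually.of_forall fun x => ?_)
  by_cases hx : x ∈ centredPeriod <;> simp [hx]

theorem integrable_indicator_of_memLp {F : ℝ → ℂ}
    (hF : MemLp (centredPeriod.indicator F) 2 volume) :
    Integrable (centredPeriod.indicator F) := by
  rw [memLp_indicator_iff_restrict measurableSet_centredPeriod] at hF
  rw [integrable_indicator_iff measurableSet_centredPeriod]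
  have : IsFiniteMeasure (volume.restrict centredPeriod) :=
    ⟨by rw [Measure.restrict_apply_univ, volume_centredPeriod]; exact ENNReal.one_lt_top⟩
  exact hF.integrable (by norm_num)

/-- Input for polarization, which lifts Parseval's identity from norms to inner products. -/
theorem hasSum_norm_fourier_add_smul_sq {F G : ℝ → ℂ}
    (hF : MemLp (centredPeriod.indicator F) 2 volume)
    (hG : MemLp (centredPeriod.indicator G) 2 volume) (c : ℂ) :
    HasSum (fun k : ℤ => ‖𝓕 (centredPeriod.indicator F) k + c • 𝓕 (centredPeriod.indicator G) k‖ ^ 2)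
      (‖hF.toLp _ + c • hG.toLp _‖ ^ 2) := by
  have e : centredPeriod.indicator (F + c • G) =
      centredPeriod.indicator F + c • centredPeriod.indicator G := by
    funext x
    by_cases hx : x ∈ centredPeriod <;> simp [hx]
  have hH : MemLp (centredPeriod.indicator (F + c • G)) 2 volume := by
    rw [e]; exact hF.add (hG.const_smul c)
  have h := hasSum_norm_fourier_sq hH
  have e2 : hH.toLp _ = hF.toLp _ + c • hG.toLp _ := by
    rw [← MemLp.toLp_const_smul, ← MemLp.toLp_add]
    congr 1
  rw [e2] at h
  have e3 : ∀ k : ℝ, 𝓕 (centredPeriod.indicator (F + c • G)) k =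
      𝓕 (centredPeriod.indicator F) k + c • 𝓕 (centredPeriod.indicator G) k := by
    intro k
    have hi : ∀ {W : ℝ → ℂ}, MemLp (centredPeriod.indicator W) 2 volume → Integrable fun x =>
        Complex.exp (((-2 * Real.pi * x * k : ℝ) : ℂ) * Complex.I) *
          centredPeriod.indicator W x := fun hW =>
      (integrable_indicator_of_memLp hW).bdd_mul (c := 1)
        (Continuous.aestronglyMeasurable (by fun_prop))
        (Eventually.of_forall fun x => (Complex.norm_exp_ofReal_mul_I _).le)
    simp only [Real.fourier_real_eq_integral_exp_smul, smul_eq_mul]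
    rw [← integral_const_mul, ← integral_add (hi hF) ((hi hG).const_mul c), e]
    refine integral_congr_ae (Eventually.of_forall fun x => ?_)
    simp only [Pi.add_apply, Pi.smul_apply, smul_eq_mul]
    ring
  simpa only [e3] using h

/-- Parseval's identity on a period, in terms of the Fourier transform on the line. -/
theorem hasSum_fourier_mul_conj {F G : ℝ → ℂ}
    (hF : MemLp (centredPeriod.indicator F) 2 volume)
    (hG : MemLp (centredPeriod.indicator G) 2 volume) :
    HasSum (fun k : ℤ => 𝓕 (centredPeriod.indicator G) k *
      (starRingEnd ℂ) (𝓕 (centredPeriod.indicator F) k))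
      (inner ℂ (hF.toLp _) (hG.toLp _)) := by
  have h := fun c : ℂ => (Complex.hasSum_ofReal.2 (hasSum_norm_fourier_add_smul_sq hF hG c))
  -- Polarization with the four coefficients ±1, ±i, applied both termwise and to the L² vectors.
  have H := (((h 1).sub (h (-1))).add
    (((h (-Complex.I)).sub (h Complex.I)).mul_right Complex.I)).div_const 4
  have e : inner ℂ (hF.toLp _) (hG.toLp _) = _ :=
    inner_eq_sum_norm_sq_div_four (𝕜 := ℂ) (hF.toLp _) (hG.toLp _)
  rw [e]
  have H' := H.congr_fun (g := fun k : ℤ => 𝓕 (centredPeriod.indicator G) k *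
      (starRingEnd ℂ) (𝓕 (centredPeriod.indicator F) k)) fun k => by
    have := inner_eq_sum_norm_sq_div_four (𝕜 := ℂ) (𝓕 (centredPeriod.indicator F) k)
      (𝓕 (centredPeriod.indicator G) k)
    rw [RCLike.inner_apply] at this
    rw [this]
    simp [sub_eq_add_neg]
  refine Eq.subst (motive := fun z => HasSum _ z) ?_ H'
  simp [sub_eq_add_neg]

theorem norm_exp_two_pi (x : ℝ) : ‖Complex.exp (2 * Real.pi * Complex.I * x)‖ = 1 := by
  rw [show 2 * Real.pi * Complex.I * x = ((2 * Real.pi * x : ℝ) : ℂ) * Complex.I by push_cast; ring]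
  exact Complex.norm_exp_ofReal_mul_I _

theorem fourierCoeff_eq_fourier_of_periodize {g : UnitAddCircle → ℂ} {u : ℝ → ℂ}
    (hg : ∀ᵐ x : ℝ, g (x : UnitAddCircle) = ∑' n : ℤ, u (x - n)) (hu : Integrable u) (k : ℤ) :
    fourierCoeff g k = 𝓕 u k := by
  rw [← fourier_periodize hu, fourier_indicator_eq, fourierCoeff_eq_intervalIntegral _ _ (-(1 / 2))]
  have h1 : (-(1 / 2) + 1 : ℝ) = 1 / 2 := by norm_num
  rw [h1, ← integral_centredPeriod, div_one, one_smul]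
  refine integral_congr_ae ?_
  filter_upwards [ae_restrict_of_ae hg] with x hx
  simp only [hx, periodize, fourier_coe_apply, smul_eq_mul]
  congr 2
  push_cast
  ring

/-! ### The Breitenberger constant as a Hilbert space expression -/

section Breitenberger

variable {c : ℤ → ℂ}

/-- The strict inequality forces a nonzero trigonometric moment and so keeps the quotient finite. -/
theorem angularVariance_eq {N V : ℝ} (hN : coeffNormSq c = N) (hVN : V < N ^ 2)
    (hτ : ‖trigMoment c‖ ^ 2 = N ^ 2 - V) :
    angularVariance c = ENNReal.ofReal (V / (N ^ 2 - V)) := by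
  have h : 0 < N ^ 2 - V := by linarith
  rw [angularVariance, hN, hτ, ← ENNReal.ofReal_div_of_pos h, ← ENNReal.ofReal_one,
    ← ENNReal.ofReal_sub _ zero_le_one]
  congr 1
  field_simp
  ring

theorem frequencyVariance_eq {N K₁ K₂ : ℝ} (hN : coeffNormSq c = N) (hN0 : 0 < N)
    (hK₁ : ∑' k : ℤ, (k : ℝ) * ‖c k‖ ^ 2 = K₁)
    (hK₂ : HasSum (fun k : ℤ => (k : ℝ) ^ 2 * ‖c k‖ ^ 2) K₂) :
    frequencyVariance c = ENNReal.ofReal ((N * K₂ - K₁ ^ 2) / N ^ 2) := by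
  rw [frequencyVariance, ← ENNReal.ofReal_tsum_of_nonneg (fun k => by positivity) hK₂.summable,
    hK₂.tsum_eq, hK₁, hN, ← ENNReal.ofReal_div_of_pos hN0, ← ENNReal.ofReal_sub _ (by positivity)]
  congr 1
  field_simp

/-- This shift makes the trigonometric moment an inner product of p with e^{2πix}·p. -/
theorem fourier_exp_mul {F : ℝ → ℂ} (k : ℤ) :
    𝓕 (centredPeriod.indicator fun x => Complex.exp (2 * Real.pi * Complex.I * x) * F x) k =
      𝓕 (centredPeriod.indicator F) ((k - 1 : ℤ) : ℝ) := by
  rw [fourier_indicator_eq, fourier_indicator_eq]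
  refine integral_congr_ae (Eventually.of_forall fun x => ?_)
  simp only [← mul_assoc, ← Complex.exp_add]
  congr 2
  push_cast
  ring

/-- The Breitenberger constant of the periodization of `u` in terms of inner products of the
functions `p`, `(e^{2πix} - 1) p` and `q` on a period, where `p` and `q` are the periodizations of
`u` and of `u'`. -/
theorem breitenbergerUC_eq {g : UnitAddCircle → ℂ} {u : ℝ → ℂ}
    (hg : ∀ᵐ x : ℝ, g (x : UnitAddCircle) = ∑' n : ℤ, u (x - n))
    (hu : Integrable u) (hAC : LocallyAC u) (hu' : Integrable (deriv u))
    (hlim : Tendsto u (cocompact ℝ) (𝓝 0))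
    (hA : MemLp (centredPeriod.indicator (periodize u)) 2 volume)
    (hB : MemLp (centredPeriod.indicator fun x =>
      (Complex.exp (2 * Real.pi * Complex.I * x) - 1) * periodize u x) 2 volume)
    (hD : MemLp (centredPeriod.indicator (periodize (deriv u))) 2 volume)
    (h0 : hA.toLp _ ≠ 0)
    (hV : ‖hA.toLp _‖ ^ 2 * ‖hB.toLp _‖ ^ 2 - ‖inner ℂ (hA.toLp _) (hB.toLp _)‖ ^ 2 <
      ‖hA.toLp _‖ ^ 4) :
    breitenbergerUC g = ENNReal.ofReal (uncertainty (hA.toLp _) (hB.toLp _) (hD.toLp _) /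
      (1 - (‖hA.toLp _‖ ^ 2 * ‖hB.toLp _‖ ^ 2 - ‖inner ℂ (hA.toLp _) (hB.toLp _)‖ ^ 2) /
        ‖hA.toLp _‖ ^ 4)) ^ (1 / 2 : ℝ) := by
  have hpi := Real.pi_pos
  have hc : fourierCoeff g = fun k : ℤ => 𝓕 u k :=
    funext fun k => fourierCoeff_eq_fourier_of_periodize hg hu k
  have hcA : ∀ k : ℤ, 𝓕 (centredPeriod.indicator (periodize u)) k = 𝓕 u k := fourier_periodize hu
  have hcD : ∀ k : ℤ, 𝓕 (centredPeriod.indicator (periodize (deriv u))) k =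
      2 * Real.pi * Complex.I * (k : ℝ) * 𝓕 u k := fun k => by
    rw [fourier_periodize hu', fourier_deriv_of_locallyAC hAC hu hu' hlim]
  have hE : MemLp (centredPeriod.indicator fun x =>
      Complex.exp (2 * Real.pi * Complex.I * x) * periodize u x) 2 volume := by
    refine (hA.add hB).ae_eq (Eventually.of_forall fun x => ?_)
    by_cases hx : x ∈ centredPeriod
    · simp [hx]; ring
    · simp [hx]
  have hEeq : hE.toLp _ = hA.toLp _ + hB.toLp _ := by
    rw [← MemLp.toLp_add]
    refine MemLp.toLp_congr _ _ (Eventually.of_forall fun x => ?_)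
    by_cases hx : x ∈ centredPeriod
    · simp [hx]; ring
    · simp [hx]
  have hcE : ∀ k : ℤ, 𝓕 (centredPeriod.indicator fun x =>
      Complex.exp (2 * Real.pi * Complex.I * x) * periodize u x) k = 𝓕 u ((k - 1 : ℤ) : ℝ) :=
    fun k => by rw [fourier_exp_mul, hcA]
  have hEn : ‖hE.toLp _‖ ^ 2 = ‖hA.toLp _‖ ^ 2 := by
    rw [norm_toLp_sq, norm_toLp_sq]
    refine integral_congr_ae (Eventually.of_forall fun x => ?_)
    by_cases hx : x ∈ centredPeriod
    · simp [hx, norm_exp_two_pi]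
    · simp [hx]
  set A := hA.toLp _ with hAdef
  set B := hB.toLp _ with hBdef
  set D := hD.toLp _ with hDdef
  have hA0 : 0 < ‖A‖ := norm_pos_iff.2 h0
  have sN : coeffNormSq (fun k : ℤ => 𝓕 u k) = ‖A‖ ^ 2 := by
    have := hasSum_norm_fourier_sq hA
    simp only [hcA] at this
    exact this.tsum_eq
  have sτ : trigMoment (fun k : ℤ => 𝓕 u k) = inner ℂ A (A + B) := by
    have := hasSum_fourier_mul_conj hA hE
    simp only [hcA, hcE, hEeq] at this
    exact this.tsum_eq
  have sK₂ : HasSum (fun k : ℤ => (k : ℝ) ^ 2 * ‖𝓕 u k‖ ^ 2) (((2 * Real.pi) ^ 2)⁻¹ * ‖D‖ ^ 2) := by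
    refine ((hasSum_norm_fourier_sq hD).mul_left ((2 * Real.pi) ^ 2)⁻¹).congr_fun fun k => ?_
    simp only [hcD, norm_mul, Complex.norm_ofNat, Complex.norm_real, Complex.norm_I,
      Real.norm_eq_abs, abs_of_pos hpi, mul_pow, sq_abs]
    field_simp
  have sK₁ : HasSum (fun k : ℤ => (((k : ℝ) * ‖𝓕 u k‖ ^ 2 : ℝ) : ℂ))
      ((2 * Real.pi * Complex.I)⁻¹ * inner ℂ A D) := by
    refine ((hasSum_fourier_mul_conj hA hD).mul_left (2 * Real.pi * Complex.I)⁻¹).congr_fun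
      fun k => ?_
    have h2 : (2 * Real.pi * Complex.I : ℂ) ≠ 0 := by simp [hpi.ne']
    rw [hcD, hcA, mul_assoc _ (𝓕 u k), RCLike.mul_conj]
    field_simp
    push_cast
    rfl
  have sK₁' : (∑' k : ℤ, (k : ℝ) * ‖𝓕 u k‖ ^ 2) ^ 2 = ((2 * Real.pi) ^ 2)⁻¹ * ‖inner ℂ A D‖ ^ 2 := by
    have h := sK₁.tsum_eq
    rw [← Complex.ofReal_tsum] at h
    have h2 := congrArg (fun z : ℂ => ‖z‖ ^ 2) h
    simp only [norm_mul, norm_inv, Complex.norm_ofNat, Complex.norm_real, Complex.norm_I,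
      Real.norm_eq_abs, abs_of_pos hpi, mul_pow, sq_abs, inv_pow, mul_one] at h2
    rw [h2]
    ring
  set V := ‖A‖ ^ 2 * ‖B‖ ^ 2 - ‖inner ℂ A B‖ ^ 2 with hVdef
  -- Multiplication by e^{2πix} is isometric, so ‖A + B‖ = ‖A‖ and 2 Re⟨A, B⟩ = -‖B‖². Expanding
  -- |‖A‖² + ⟨A, B⟩|² then leaves exactly ‖A‖⁴ minus the Gram determinant of A and B.
  have hVτ : ‖trigMoment (fun k : ℤ => 𝓕 u k)‖ ^ 2 = (‖A‖ ^ 2) ^ 2 - V := by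
    have h1 := norm_add_sq (𝕜 := ℂ) A B
    rw [← hEeq, hEn] at h1
    rw [sτ, inner_add_right, inner_self_eq_norm_sq_to_K, ← Complex.normSq_eq_norm_sq,
      Complex.normSq_apply, hVdef, ← Complex.normSq_eq_norm_sq (inner ℂ A B), Complex.normSq_apply]
    have e1 : (((RCLike.ofReal ‖A‖ : ℂ)) ^ 2 + inner ℂ A B).re = ‖A‖ ^ 2 + (inner ℂ A B).re := by
      change (((‖A‖ : ℝ) : ℂ) ^ 2 + inner ℂ A B).re = _
      rw [← Complex.ofReal_pow, Complex.add_re, Complex.ofReal_re]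
    have e2 : (((RCLike.ofReal ‖A‖ : ℂ)) ^ 2 + inner ℂ A B).im = (inner ℂ A B).im := by
      change (((‖A‖ : ℝ) : ℂ) ^ 2 + inner ℂ A B).im = _
      rw [← Complex.ofReal_pow, Complex.add_im, Complex.ofReal_im, zero_add]
    rw [e1, e2]
    simp only [RCLike.re_to_complex] at h1
    linear_combination ‖A‖ ^ 2 * (-h1)
  rw [breitenbergerUC, hc, angularVariance_eq sN (by rw [← pow_mul]; exact hV) hVτ,
    frequencyVariance_eq sN (by positivity) rfl sK₂, sK₁', ← ENNReal.ofReal_mul]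
  · congr 2
    have h1 : ‖A‖ ^ 4 - V ≠ 0 := by linarith
    have h2 : 1 - V / ‖A‖ ^ 4 = (‖A‖ ^ 4 - V) / ‖A‖ ^ 4 := by field_simp
    rw [uncertainty, ← hVdef, h2]
    have h3 : (‖A‖ ^ 2) ^ 2 - V ≠ 0 := by rw [← pow_mul]; exact h1
    rw [← pow_mul] at *
    field_simp
  · exact div_nonneg (gram_nonneg A B) (by linarith [show (‖A‖ ^ 2) ^ 2 = ‖A‖ ^ 4 by ring])

end Breitenberger

/-! ### Decay at infinity and the tail of a periodization -/

theorem integrable_of_isBigO_abs_rpow {g : ℝ → ℝ} (hg : LocallyIntegrable g) {s : ℝ} (hs : 1 < s)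
    (hO : g =O[cocompact ℝ] fun x => |x| ^ (-s)) : Integrable g := by
  refine hg.integrable_of_isBigO_cocompact (g := fun x => (1 + ‖x‖) ^ (-s)) (hO.trans ?_)
    ((integrable_one_add_norm (by simpa using hs)).integrableAtFilter _)
  refine Asymptotics.IsBigO.of_bound (2 ^ s) ?_
  have h1 : ∀ᶠ x : ℝ in cocompact ℝ, 1 ≤ ‖x‖ := tendsto_norm_cocompact_atTop.eventually_ge_atTop 1
  filter_upwards [h1] with x hx
  rw [Real.norm_of_nonneg (by positivity), Real.norm_of_nonneg (by positivity), ← Real.norm_eq_abs]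
  have h2 : (1 + ‖x‖) / 2 ≤ ‖x‖ := by linarith
  calc ‖x‖ ^ (-s) ≤ ((1 + ‖x‖) / 2) ^ (-s) :=
        Real.rpow_le_rpow_of_nonpos (by positivity) h2 (by linarith)
    _ = 2 ^ s * (1 + ‖x‖) ^ (-s) := by
        rw [Real.div_rpow (by positivity) (by norm_num), Real.rpow_neg (by norm_num : (0 : ℝ) ≤ 2)]
        field_simp

theorem exists_bound_of_isBigO_abs_rpow {g : ℝ → ℝ} {s : ℝ}
    (hO : g =O[cocompact ℝ] fun x => |x| ^ (-s)) :
    ∃ C Y : ℝ, 0 ≤ C ∧ 0 < Y ∧ ∀ y, Y ≤ |y| → g y ≤ C * |y| ^ (-s) := by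
  obtain ⟨C, hC, h⟩ := hO.exists_nonneg
  rw [Asymptotics.IsBigOWith, ← Metric.cobounded_eq_cocompact, ← comap_norm_atTop, eventually_comap] at h
  obtain ⟨Y, hY⟩ := eventually_atTop.1 h
  refine ⟨C, max Y 1, hC, by positivity, fun y hy => ?_⟩
  have := hY |y| ((le_max_left _ _).trans hy) y rfl
  rw [Real.norm_of_nonneg (by positivity : 0 ≤ |y| ^ (-s))] at this
  exact (le_abs_self _).trans this

theorem half_abs_le_abs_sub_int {x : ℝ} (hx : x ∈ centredPeriod) {n : ℤ} (hn : n ≠ 0) :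
    |(n : ℝ)| / 2 ≤ |x - n| := by
  have h1 : |x| ≤ 1 / 2 := abs_le.2 ⟨hx.1.le, hx.2⟩
  have h2 : (1 : ℝ) ≤ |(n : ℝ)| := by exact_mod_cast Int.one_le_abs hn
  have h3 := abs_sub_abs_le_abs_sub (n : ℝ) x
  rw [abs_sub_comm] at h3
  linarith

/-- The remainder of the periodization of a function concentrated at the scale `1 / L`. -/
theorem ae_norm_periodize_sub_le {v : ℝ → ℂ} {F : ℝ → ℝ} {L C Y β : ℝ} (hβ : 1 < β)
    (hC : 0 ≤ C) (hL : 2 * Y ≤ L) (hL0 : 0 < L) (hF : ∀ y, Y ≤ |y| → F y ≤ C * |y| ^ (-β))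
    (hvi : Integrable v) (hv : ∀ᵐ x, ‖v x‖ ≤ √L * F (L * x)) :
    ∀ᵐ x ∂(volume.restrict centredPeriod), ‖periodize v x - v x‖ ≤
      (C * 2 ^ β * ∑' n : ℤ, |(n : ℝ)| ^ (-β)) * (√L * L ^ (-β)) := by
  have hall : ∀ᵐ x : ℝ, ∀ n : ℤ, ‖v (x - n)‖ ≤ √L * F (L * (x - n)) :=
    ae_all_iff.2 fun n => (measurePreserving_sub_right volume (n : ℝ)).quasiMeasurePreserving.ae hv
  filter_upwards [ae_summable_periodize hvi, ae_restrict_of_ae hall,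
    ae_restrict_mem measurableSet_centredPeriod] with x hs hx hxI
  have e : periodize v x - v x = ∑' n : ℤ, if n = 0 then 0 else v (x - n) := by
    -- The term n = 0 is v x itself; only nonzero translates remain.
    rw [periodize, hs.tsum_eq_add_tsum_ite 0]
    simp
  rw [e]
  have hsum := (Real.summable_abs_int_rpow hβ).hasSum.mul_left ((√L * L ^ (-β)) * (C * 2 ^ β))
  refine (tsum_of_norm_bounded hsum fun n => ?_).trans (le_of_eq (by ring))
  split_ifs with hn
  · rw [norm_zero]; positivity
  · have h1 := half_abs_le_abs_sub_int hxI hn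
    have h2 : (1 : ℝ) ≤ |(n : ℝ)| := by exact_mod_cast Int.one_le_abs hn
    have h3 : L * (|(n : ℝ)| / 2) ≤ |L * (x - n)| := by
      rw [abs_mul, abs_of_pos hL0]; gcongr
    -- This is where 2Y ≤ L enters: since |n| ≥ 1, every remaining translate lies in the region
    -- where the decay bound holds.
    have h4 : Y ≤ L * (|(n : ℝ)| / 2) := by nlinarith
    calc ‖v (x - n)‖ ≤ √L * F (L * (x - n)) := hx n
      _ ≤ √L * (C * |L * (x - n)| ^ (-β)) := by gcongr; exact hF _ (h4.trans h3)
      _ ≤ √L * (C * (L * (|(n : ℝ)| / 2)) ^ (-β)) := by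
          gcongr √L * (C * ?_)
          exact Real.rpow_le_rpow_of_nonpos (by positivity) h3 (by linarith)
      _ = √L * L ^ (-β) * (C * 2 ^ β) * |(n : ℝ)| ^ (-β) := by
          rw [Real.mul_rpow hL0.le (by positivity), Real.div_rpow (by positivity) (by norm_num),
            Real.rpow_neg (by norm_num : (0 : ℝ) ≤ 2)]
          field_simp

/-! ### Comparison of a periodized function with the original in L² -/

open scoped Classical in
/-- The class of `f` in `L²(ℝ)`, and `0` if `f` is not square integrable. -/
noncomputable def toL2 (f : ℝ → ℂ) : Lp ℂ 2 (volume : Measure ℝ) :=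
  if h : MemLp f 2 volume then h.toLp f else 0

theorem MeasureTheory.MemLp.toL2_eq {f : ℝ → ℂ} (h : MemLp f 2 volume) : toL2 f = h.toLp f :=
  dif_pos h

theorem integrable_dilate_sq {w : ℝ → ℝ} (hw : Integrable fun y => w y ^ 2) {L : ℝ} (hL : 0 < L) :
    Integrable fun x => (√L * w (L * x)) ^ 2 := by
  simp_rw [mul_pow, Real.sq_sqrt hL.le]
  exact (hw.comp_mul_left' hL.ne').const_mul _

theorem integral_dilate_sq (w : ℝ → ℝ) {L : ℝ} (hL : 0 < L) :
    ∫ x, (√L * w (L * x)) ^ 2 = ∫ y, w y ^ 2 := by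
  simp_rw [mul_pow, Real.sq_sqrt hL.le]
  rw [integral_const_mul, Measure.integral_comp_mul_left (fun y => w y ^ 2),
    abs_of_pos (by positivity), smul_eq_mul]
  field_simp

theorem memLp_two_of_norm_le_dilate {h : ℝ → ℂ} {w : ℝ → ℝ} {L : ℝ} (hL : 0 < L)
    (hh : AEStronglyMeasurable h volume) (hw : Integrable fun y => w y ^ 2)
    (hb : ∀ᵐ x, ‖h x‖ ≤ √L * w (L * x)) : MemLp h 2 volume := by
  rw [memLp_two_iff_integrable_sq_norm hh]
  refine (integrable_dilate_sq hw hL).mono' (hh.norm.pow 2) ?_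
  filter_upwards [hb] with x hx
  rw [norm_pow, norm_norm]
  gcongr

theorem norm_toL2_le_of_norm_le_dilate {h : ℝ → ℂ} {w : ℝ → ℝ} {L : ℝ} (hL : 0 < L)
    (hh : MemLp h 2 volume) (hw : Integrable fun y => w y ^ 2)
    (hb : ∀ᵐ x, ‖h x‖ ≤ √L * w (L * x)) : ‖toL2 h‖ ≤ √(∫ y, w y ^ 2) := by
  rw [hh.toL2_eq]
  exact (norm_toLp_le_of_norm_le hh (integrable_dilate_sq hw hL) hb).trans_eq
    (by rw [integral_dilate_sq w hL])

section Approximation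

variable {v : ℕ → ℝ → ℂ} {F W : ℝ → ℝ} {m : ℝ → ℂ} {mj : ℕ → ℝ → ℂ}

/-- On the real line, truncation to a period and replacement of the multiplier `mj j` by the
dilation of its limit `m` have a negligible effect. -/
theorem tendsto_integral_multiplier_sq (hF : AEStronglyMeasurable F volume)
    (hWF : Integrable fun y => (W y * F y) ^ 2)
    (hm : Continuous m) (hmj : ∀ j, Continuous (mj j))
    (hmW : ∀ y, ‖m y‖ ≤ W y) (hmjW : ∀ j y, ‖mj j (y / 2 ^ j)‖ ≤ W y)
    (hlim : ∀ y, Tendsto (fun j => mj j (y / 2 ^ j)) atTop (𝓝 (m y))) :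
    (∀ j : ℕ, Integrable fun y =>
      (‖centredPeriod.indicator (mj j) (y / 2 ^ j) - m y‖ * F y) ^ 2) ∧
    Tendsto (fun j : ℕ => ∫ y, (‖centredPeriod.indicator (mj j) (y / 2 ^ j) - m y‖ * F y) ^ 2)
      atTop (𝓝 0) := by
  have hmeas : ∀ j : ℕ, AEStronglyMeasurable (fun y =>
      (‖centredPeriod.indicator (mj j) (y / 2 ^ j) - m y‖ * F y) ^ 2) volume := fun j => by
    have h1 : Measurable fun y : ℝ => centredPeriod.indicator (mj j) (y / 2 ^ j) :=
      ((hmj j).measurable.indicator measurableSet_centredPeriod).comp (measurable_id.div_const _)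
    exact (((h1.sub hm.measurable).norm.aestronglyMeasurable).mul hF).pow 2
  -- Both the truncated multiplier and its limit are bounded by W, so their difference is at most
  -- 2W; squaring gives the factor 4 of the majorant.
  have hb : ∀ j : ℕ, ∀ y, ‖(‖centredPeriod.indicator (mj j) (y / 2 ^ j) - m y‖ * F y) ^ 2‖ ≤
      4 * (W y * F y) ^ 2 := fun j y => by
    have h1 : ‖centredPeriod.indicator (mj j) (y / 2 ^ j) - m y‖ ≤ 2 * W y := by
      refine (norm_sub_le _ _).trans ?_
      have := (norm_indicator_le_norm_self (s := centredPeriod) (mj j) (y / 2 ^ j)).trans (hmjW j y)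
      linarith [hmW y]
    rw [Real.norm_of_nonneg (sq_nonneg _), mul_pow, mul_pow, ← mul_assoc]
    gcongr
    calc _ ≤ (2 * W y) ^ 2 := by gcongr
      _ = _ := by ring
  refine ⟨fun j => (hWF.const_mul 4).mono' (hmeas j) (Eventually.of_forall (hb j)), ?_⟩
  have := tendsto_integral_of_dominated_convergence (f := fun _ => 0) _ hmeas (hWF.const_mul 4)
    (fun j => Eventually.of_forall (hb j)) (Eventually.of_forall fun y => ?_)
  · simpa using this
  have h2 : Tendsto (fun j : ℕ => y / 2 ^ j) atTop (𝓝 0) :=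
    tendsto_const_nhds.div_atTop (tendsto_pow_atTop_atTop_of_one_lt one_lt_two)
  have h3 : ∀ᶠ j : ℕ in atTop, y / 2 ^ j ∈ centredPeriod :=
    h2.eventually (Ioc_mem_nhds (by norm_num) (by norm_num))
  have h4 : Tendsto (fun j : ℕ => centredPeriod.indicator (mj j) (y / 2 ^ j)) atTop (𝓝 (m y)) := by
    refine (hlim y).congr' ?_
    filter_upwards [h3] with j hj
    rw [Set.indicator_of_mem hj]
  have h5 := (((h4.sub_const (m y)).norm).mul_const (F y)).pow 2
  simpa using h5

/-- The bound does not depend on j; this uniformity is what later gives limits along ultrafilters.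
-/
theorem memLp_multiplier (hvi : ∀ j, Integrable (v j))
    (hv : ∀ j : ℕ, ∀ᵐ x, ‖v j x‖ ≤ √(2 ^ j) * F (2 ^ j * x))
    (hWF : Integrable fun y => (W y * F y) ^ 2)
    (hm : Continuous m) (hmW : ∀ y, ‖m y‖ ≤ W y) (j : ℕ) :
    MemLp (fun x => m (2 ^ j * x) * v j x) 2 volume ∧
      ‖toL2 (fun x => m (2 ^ j * x) * v j x)‖ ≤ √(∫ y, (W y * F y) ^ 2) := by
  have hb : ∀ᵐ x, ‖m (2 ^ j * x) * v j x‖ ≤ √(2 ^ j) * (W (2 ^ j * x) * F (2 ^ j * x)) := by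
    filter_upwards [hv j] with x hx
    rw [norm_mul]
    calc _ ≤ W (2 ^ j * x) * (√(2 ^ j) * F (2 ^ j * x)) := by
          gcongr
          · exact (norm_nonneg _).trans (hmW _)
          · exact hmW _
      _ = _ := by ring
  have hmeas : AEStronglyMeasurable (fun x => m (2 ^ j * x) * v j x) volume :=
    (Continuous.aestronglyMeasurable (by fun_prop)).mul (hvi j).aestronglyMeasurable
  have h := memLp_two_of_norm_le_dilate (w := fun y => W y * F y) (by positivity) hmeas hWF hb
  exact ⟨h, norm_toL2_le_of_norm_le_dilate (w := fun y => W y * F y) (by positivity) h hWF hb⟩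

/-- The truncated periodization splits as g + h + p. Here g is the line function with the limiting
multiplier; h, the effect on the line of truncation and of changing the multiplier, is small by
dominated convergence in the dilated variable; p, the periodization tail, is bounded uniformly by a
multiple of M_j·2^(j/2)·2^(-jβ) on a set of measure one. -/
theorem tendsto_toL2_periodize {C Y β : ℝ} {M : ℕ → ℝ} (hβ : 1 < β) (hC : 0 ≤ C)
    (hFd : ∀ y, Y ≤ |y| → F y ≤ C * |y| ^ (-β))
    (hF : AEStronglyMeasurable F volume) (hvi : ∀ j, Integrable (v j))
    (hv : ∀ j : ℕ, ∀ᵐ x, ‖v j x‖ ≤ √(2 ^ j) * F (2 ^ j * x))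
    (hWF : Integrable fun y => (W y * F y) ^ 2)
    (hm : Continuous m) (hmj : ∀ j, Continuous (mj j))
    (hmW : ∀ y, ‖m y‖ ≤ W y) (hmjW : ∀ j y, ‖mj j (y / 2 ^ j)‖ ≤ W y)
    (hlim : ∀ y, Tendsto (fun j => mj j (y / 2 ^ j)) atTop (𝓝 (m y)))
    (hM : ∀ j x, ‖mj j x‖ ≤ M j)
    (hMlim : Tendsto (fun j : ℕ => M j * (√(2 ^ j) * (2 ^ j) ^ (-β))) atTop (𝓝 0)) :
    (∀ᶠ j in atTop, MemLp (centredPeriod.indicator fun x => mj j x * periodize (v j) x) 2 volume) ∧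
    Tendsto (fun j => toL2 (centredPeriod.indicator fun x => mj j x * periodize (v j) x) -
      toL2 fun x => m (2 ^ j * x) * v j x) atTop (𝓝 0) := by
  obtain ⟨hint, hzero⟩ := tendsto_integral_multiplier_sq hF hWF hm hmj hmW hmjW hlim
  set K := C * 2 ^ β * ∑' n : ℤ, |(n : ℝ)| ^ (-β) with hK
  have hpow : Tendsto (fun j : ℕ => (2 : ℝ) ^ j) atTop atTop :=
    tendsto_pow_atTop_atTop_of_one_lt one_lt_two
  have key : ∀ᶠ j : ℕ in atTop,
      MemLp (centredPeriod.indicator fun x => mj j x * periodize (v j) x) 2 volume ∧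
      ‖toL2 (centredPeriod.indicator fun x => mj j x * periodize (v j) x) -
        toL2 fun x => m (2 ^ j * x) * v j x‖ ≤
      √(∫ y, (‖centredPeriod.indicator (mj j) (y / 2 ^ j) - m y‖ * F y) ^ 2) +
        |K| * (M j * (√(2 ^ j) * (2 ^ j) ^ (-β))) := by
    filter_upwards [hpow.eventually_ge_atTop (2 * Y)] with j hj
    have hL : (0 : ℝ) < 2 ^ j := by positivity
    obtain ⟨hg, -⟩ := memLp_multiplier hvi hv hWF hm hmW j
    have hM0 : 0 ≤ M j := (norm_nonneg _).trans (hM j 0)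
    set g := fun x => m (2 ^ j * x) * v j x with hgdef
    set h := fun x => (centredPeriod.indicator (mj j) x - m (2 ^ j * x)) * v j x with hhdef
    set p := centredPeriod.indicator fun x => mj j x * (periodize (v j) x - v j x) with hpdef
    have hsplit : (centredPeriod.indicator fun x => mj j x * periodize (v j) x) = g + h + p := by
      funext x
      by_cases hx : x ∈ centredPeriod <;> simp [hgdef, hhdef, hpdef, hx]
      ring
    have hhm : AEStronglyMeasurable h volume := by
      refine AEStronglyMeasurable.mul ?_ (hvi j).aestronglyMeasurable
      exact (((hmj j).measurable.indicator measurableSet_centredPeriod).sub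
        (hm.measurable.comp (measurable_const_mul _))).aestronglyMeasurable
    have hhb : ∀ᵐ x, ‖h x‖ ≤ √(2 ^ j) * (fun y =>
        ‖centredPeriod.indicator (mj j) (y / 2 ^ j) - m y‖ * F y) (2 ^ j * x) := by
      filter_upwards [hv j] with x hx
      have e : 2 ^ j * x / 2 ^ j = x := by field_simp
      simp only [hhdef, norm_mul, e]
      calc _ ≤ ‖centredPeriod.indicator (mj j) x - m (2 ^ j * x)‖ *
            (√(2 ^ j) * F (2 ^ j * x)) := by gcongr
        _ = _ := by ring
    have hhL := memLp_two_of_norm_le_dilate hL hhm (hint j) hhb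
    have hhn := norm_toL2_le_of_norm_le_dilate hL hhL (hint j) hhb
    set B := |K| * (M j * (√(2 ^ j) * (2 ^ j) ^ (-β))) with hB
    have hB0 : 0 ≤ B := by positivity
    have hpb : ∀ᵐ x, ‖p x‖ ≤ centredPeriod.indicator (fun _ => B) x := by
      have h1 := ae_norm_periodize_sub_le hβ hC hj hL hFd (hvi j) (hv j)
      rw [ae_restrict_iff' measurableSet_centredPeriod] at h1
      filter_upwards [h1] with x hx
      by_cases hxI : x ∈ centredPeriod
      · simp only [hpdef, Set.indicator_of_mem hxI, norm_mul]
        calc _ ≤ M j * (K * (√(2 ^ j) * (2 ^ j) ^ (-β))) := by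
              gcongr
              · exact hM j x
              · exact hx hxI
          _ ≤ M j * (|K| * (√(2 ^ j) * (2 ^ j) ^ (-β))) := by gcongr; exact le_abs_self K
          _ = B := by rw [hB]; ring
      · simp [hpdef, hxI]
    have hBi : Integrable fun x => (centredPeriod.indicator (fun _ => B) x) ^ 2 := by
      have e : (fun x => (centredPeriod.indicator (fun _ => B) x) ^ 2) =
          centredPeriod.indicator fun _ => B ^ 2 := by
        funext x
        by_cases hx : x ∈ centredPeriod <;> simp [hx]
      rw [e, integrable_indicator_iff measurableSet_centredPeriod]
      exact integrableOn_const (by rw [volume_centredPeriod]; exact ENNReal.one_ne_top)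
    have hBI : ∫ x, (centredPeriod.indicator (fun _ => B) x) ^ 2 = B ^ 2 := by
      have e : (fun x => (centredPeriod.indicator (fun _ => B) x) ^ 2) =
          centredPeriod.indicator fun _ => B ^ 2 := by
        funext x
        by_cases hx : x ∈ centredPeriod <;> simp [hx]
      rw [e, integral_indicator measurableSet_centredPeriod, setIntegral_const, Measure.real,
        volume_centredPeriod]
      simp
    have hpm : AEStronglyMeasurable p volume := by
      rw [hpdef, aestronglyMeasurable_indicator_iff measurableSet_centredPeriod]
      exact (hmj j).aestronglyMeasurable.mul
        ((aestronglyMeasurable_periodize (hvi j)).sub (hvi j).aestronglyMeasurable.restrict)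
    have hpL : MemLp p 2 volume := by
      rw [memLp_two_iff_integrable_sq_norm hpm]
      refine hBi.mono' (hpm.norm.pow 2) ?_
      filter_upwards [hpb] with x hx
      rw [norm_pow, norm_norm]
      gcongr
    have hpn : ‖toL2 p‖ ≤ B := by
      rw [hpL.toL2_eq]
      refine (norm_toLp_le_of_norm_le hpL hBi hpb).trans_eq ?_
      rw [hBI, Real.sqrt_sq hB0]
    have hfL : MemLp (g + h + p) 2 volume := (hg.add hhL).add hpL
    rw [hsplit]
    refine ⟨hfL, ?_⟩
    have e : toL2 (g + h + p) - toL2 g = toL2 h + toL2 p := by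
      rw [hfL.toL2_eq, hg.toL2_eq, hhL.toL2_eq, hpL.toL2_eq, MemLp.toLp_add (hg.add hhL) hpL,
        MemLp.toLp_add hg hhL]
      abel
    rw [e]
    exact (norm_add_le _ _).trans (add_le_add hhn hpn)
  refine ⟨key.mono fun j h => h.1, ?_⟩
  refine squeeze_zero_norm' (key.mono fun j h => h.2) ?_
  have := (hzero.sqrt).add (hMlim.const_mul |K|)
  simpa using this

end Approximation

/-! ### Limits of the uncertainty expression along ultrafilters -/

section Ultrafilter

theorem Ultrafilter.exists_tendsto_of_norm_le {ι E : Type*} [SeminormedAddCommGroup E]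
    [ProperSpace E] (U : Ultrafilter ι) {s : ι → E} {C : ℝ} (h : ∀ j, ‖s j‖ ≤ C) :
    ∃ y, Tendsto s U (𝓝 y) := by
  obtain ⟨y, -, hy⟩ := (isCompact_closedBall (0 : E) C).ultrafilter_le_nhds (U.map s) (by
    rw [le_principal_iff]
    exact mem_map.2 (Eventually.of_forall fun j => by simpa using h j))
  exact ⟨y, hy⟩

variable {ι H : Type*} [NormedAddCommGroup H] [InnerProductSpace ℂ H]

theorem tendsto_norm_of_sub {E : Type*} [SeminormedAddCommGroup E] {l : Filter ι} {a a' : ι → E}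
    (h : Tendsto (fun j => a j - a' j) l (𝓝 0))
    {α : ℝ} (ha : Tendsto (fun j => ‖a' j‖) l (𝓝 α)) : Tendsto (fun j => ‖a j‖) l (𝓝 α) := by
  have h1 : Tendsto (fun j => ‖a j‖ - ‖a' j‖) l (𝓝 0) :=
    squeeze_zero_norm (a := fun j => ‖a j - a' j‖) (fun j => by
      rw [Real.norm_eq_abs]; exact abs_norm_sub_norm_le (a j) (a' j)) (by simpa using h.norm)
  simpa using h1.add ha

theorem tendsto_inner_of_sub {l : Filter ι} {a a' x x' : ι → H}
    (ha : Tendsto (fun j => a j - a' j) l (𝓝 0)) (hx : Tendsto (fun j => x j - x' j) l (𝓝 0))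
    {α ξ : ℝ} (hna : Tendsto (fun j => ‖a' j‖) l (𝓝 α)) (hnx : Tendsto (fun j => ‖x' j‖) l (𝓝 ξ))
    {z : ℂ} (hz : Tendsto (fun j => inner ℂ (a' j) (x' j)) l (𝓝 z)) :
    Tendsto (fun j => inner ℂ (a j) (x j)) l (𝓝 z) := by
  have hnx' := tendsto_norm_of_sub hx hnx
  have h0 : Tendsto (fun j => inner ℂ (a j) (x j) - inner ℂ (a' j) (x' j)) l (𝓝 0) := by
    refine squeeze_zero_norm (a := fun j => ‖a j - a' j‖ * ‖x j‖ + ‖a' j‖ * ‖x j - x' j‖)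
      (fun j => ?_) ?_
    · have e : inner ℂ (a j) (x j) - inner ℂ (a' j) (x' j) =
          inner ℂ (a j - a' j) (x j) + inner ℂ (a' j) (x j - x' j) := by
        rw [inner_sub_left, inner_sub_right]; ring
      rw [e]
      exact (norm_add_le _ _).trans (add_le_add (norm_inner_le_norm _ _) (norm_inner_le_norm _ _))
    · simpa using (ha.norm.mul hnx').add (hna.mul hx.norm)
  simpa using h0.add hz

/-- `uncertainty` depends only on norms and inner products, which are bounded and so converge along
`U` without any compactness in `H`. Perturbing the vectors by o(1) leaves these limits unchanged,
and the lower bound on ‖a'‖ keeps the denominators away from zero. -/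
theorem exists_tendsto_uncertainty (U : Ultrafilter ι) {a a' x x' d d' : ι → H}
    (ha : Tendsto (fun j => a j - a' j) U (𝓝 0)) (hx : Tendsto (fun j => x j - x' j) U (𝓝 0))
    (hd : Tendsto (fun j => d j - d' j) U (𝓝 0)) {Ca Cx Cd c : ℝ} (hCa : ∀ j, ‖a' j‖ ≤ Ca)
    (hCx : ∀ j, ‖x' j‖ ≤ Cx) (hCd : ∀ j, ‖d' j‖ ≤ Cd) (hc : 0 < c)
    (hac : ∀ᶠ j in U, c ≤ ‖a' j‖) :
    ∃ G R α : ℝ, 0 < α ∧ Tendsto (fun j => ‖a j‖) U (𝓝 α) ∧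
      Tendsto (fun j => uncertainty (a j) (x j) (d j)) U (𝓝 G) ∧
      Tendsto (fun j => uncertainty (a' j) (x' j) (d' j)) U (𝓝 G) ∧
      Tendsto (fun j => (‖a j‖ ^ 2 * ‖x j‖ ^ 2 - ‖inner ℂ (a j) (x j)‖ ^ 2) / ‖a j‖ ^ 4) U
        (𝓝 R) := by
  have hi : ∀ {y : ι → H} {C : ℝ}, (∀ j, ‖y j‖ ≤ C) → ∀ j, ‖inner ℂ (a' j) (y j)‖ ≤ Ca * C :=
    fun {y C} hy j => (norm_inner_le_norm _ _).trans
      (mul_le_mul (hCa j) (hy j) (norm_nonneg _) ((norm_nonneg _).trans (hCa j)))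
  obtain ⟨α, hα⟩ := U.exists_tendsto_of_norm_le (s := fun j => ‖a' j‖) (C := Ca) (by simpa using hCa)
  obtain ⟨ξ, hξ⟩ := U.exists_tendsto_of_norm_le (s := fun j => ‖x' j‖) (C := Cx) (by simpa using hCx)
  obtain ⟨δ, hδ⟩ := U.exists_tendsto_of_norm_le (s := fun j => ‖d' j‖) (C := Cd) (by simpa using hCd)
  obtain ⟨p, hp⟩ := U.exists_tendsto_of_norm_le (hi hCx)
  obtain ⟨q, hq⟩ := U.exists_tendsto_of_norm_le (hi hCd)
  have hα0 : 0 < α := hc.trans_le (ge_of_tendsto hα hac)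
  have hα4 : α ^ 4 ≠ 0 := by positivity
  have main : ∀ {b y : ι → H} {ζ : ℝ} {w : ℂ}, Tendsto (fun j => ‖b j‖) U (𝓝 α) →
      Tendsto (fun j => ‖y j‖) U (𝓝 ζ) → Tendsto (fun j => inner ℂ (b j) (y j)) U (𝓝 w) →
      Tendsto (fun j => (‖b j‖ ^ 2 * ‖y j‖ ^ 2 - ‖inner ℂ (b j) (y j)‖ ^ 2) / ‖b j‖ ^ 4) U
        (𝓝 ((α ^ 2 * ζ ^ 2 - ‖w‖ ^ 2) / α ^ 4)) := fun hb hy hw =>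
    ((((hb.pow 2).mul (hy.pow 2)).sub (hw.norm.pow 2)).div (hb.pow 4) hα4)
  have ha1 := tendsto_norm_of_sub ha hα
  have m1 := main ha1 (tendsto_norm_of_sub hx hξ) (tendsto_inner_of_sub ha hx hα hξ hp)
  have m2 := main ha1 (tendsto_norm_of_sub hd hδ) (tendsto_inner_of_sub ha hd hα hδ hq)
  exact ⟨_, _, α, hα0, ha1, (m1.mul m2).div_const _,
    ((main hα hξ hp).mul (main hα hδ hq)).div_const _, m1⟩

theorem uncertainty_smul (a x d : H) {s : ℝ} (hs : s ≠ 0) :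
    uncertainty a ((s : ℂ) • x) ((s : ℂ)⁻¹ • d) = uncertainty a x d := by
  simp only [uncertainty, norm_smul, inner_smul_right, norm_mul, norm_inv, Complex.norm_real,
    Real.norm_eq_abs, mul_pow, inv_pow, sq_abs]
  field_simp

end Ultrafilter

/-! ### Both constants in dilated form -/

section Scaled

variable {u : ℝ → ℂ} {L : ℝ}

theorem toL2_const_mul {f : ℝ → ℂ} (hf : MemLp f 2 volume) (c : ℂ) :
    toL2 (fun x => c * f x) = c • toL2 f := by
  have h : MemLp (fun x => c * f x) 2 volume := hf.const_mul c
  rw [h.toL2_eq, hf.toL2_eq, ← MemLp.toLp_const_smul]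
  rfl

theorem indicator_const_mul_eq (s : Set ℝ) (c : ℂ) (f : ℝ → ℂ) :
    (s.indicator fun x => c * f x) = fun x => c * s.indicator f x := by
  funext x
  by_cases hx : x ∈ s <;> simp [hx]

/-- The factors 1 give all three vectors the shape multiplier times function required by
`tendsto_toL2_periodize`. The factors L and 1/L cancel by `uncertainty_smul`. -/
theorem heisenbergUC_eq_dilated (hL : L ≠ 0) (hu : MemLp u 2 volume) (hAC : LocallyAC u)
    (hi : Integrable u) (hi' : Integrable (deriv u)) (hd : MemLp (deriv u) 2 volume)
    (hx : MemLp (fun x : ℝ => 2 * Real.pi * Complex.I * x * u x) 2 volume)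
    (hlim : Tendsto u (cocompact ℝ) (𝓝 0)) (h0 : hu.toLp u ≠ 0) :
    heisenbergUC u hu = ENNReal.ofReal (uncertainty (toL2 fun x => 1 * u x)
      (toL2 fun x : ℝ => (2 * Real.pi * Complex.I * ((L * x : ℝ) : ℂ)) * u x)
      (toL2 fun x => 1 * ((L : ℂ)⁻¹ * deriv u x))) ^ (1 / 2 : ℝ) := by
  have e1 : (fun x : ℝ => (2 * Real.pi * Complex.I * ((L * x : ℝ) : ℂ)) * u x) =
      fun x : ℝ => (L : ℂ) * (2 * Real.pi * Complex.I * x * u x) := by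
    funext x; push_cast; ring
  rw [heisenbergUC_eq hu hAC hi hi' hd hx hlim h0, e1]
  simp only [one_mul]
  rw [toL2_const_mul hx, toL2_const_mul hd, uncertainty_smul _ _ _ hL, hu.toL2_eq, hx.toL2_eq,
    hd.toL2_eq]

/-- Rescaling the second vector by L leaves the uncertainty product invariant but exposes a factor
L⁻² in the correction term of the denominator, which therefore disappears in the limit. -/
theorem breitenbergerUC_eq_dilated {g : UnitAddCircle → ℂ} (hL : 0 < L)
    (hg : ∀ᵐ x : ℝ, g (x : UnitAddCircle) = ∑' n : ℤ, u (x - n))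
    (hu : Integrable u) (hAC : LocallyAC u) (hu' : Integrable (deriv u))
    (hlim : Tendsto u (cocompact ℝ) (𝓝 0))
    (hA : MemLp (centredPeriod.indicator fun x => 1 * periodize u x) 2 volume)
    (hB : MemLp (centredPeriod.indicator fun x =>
      (L * (Complex.exp (2 * Real.pi * Complex.I * x) - 1)) * periodize u x) 2 volume)
    (hD : MemLp (centredPeriod.indicator fun x =>
      1 * periodize (fun y => (L : ℂ)⁻¹ * deriv u y) x) 2 volume)
    {A B D : Lp ℂ 2 (volume : Measure ℝ)} (eA : hA.toLp _ = A) (eB : hB.toLp _ = B)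
    (eD : hD.toLp _ = D)
    (h0 : A ≠ 0) (hV : (‖A‖ ^ 2 * ‖B‖ ^ 2 - ‖inner ℂ A B‖ ^ 2) / ‖A‖ ^ 4 * (L⁻¹) ^ 2 < 1) :
    breitenbergerUC g = ENNReal.ofReal (uncertainty A B D /
      (1 - (‖A‖ ^ 2 * ‖B‖ ^ 2 - ‖inner ℂ A B‖ ^ 2) / ‖A‖ ^ 4 * (L⁻¹) ^ 2)) ^ (1 / 2 : ℝ) := by
  have hLc : (L : ℂ) ≠ 0 := by exact_mod_cast hL.ne'
  have fA : (centredPeriod.indicator fun x => 1 * periodize u x) =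
      centredPeriod.indicator (periodize u) := by simp only [one_mul]
  have fB : (centredPeriod.indicator fun x : ℝ =>
      (Complex.exp (2 * Real.pi * Complex.I * x) - 1) * periodize u x) =
      fun x => (L : ℂ)⁻¹ * centredPeriod.indicator (fun x =>
        (L * (Complex.exp (2 * Real.pi * Complex.I * x) - 1)) * periodize u x) x := by
    rw [← indicator_const_mul_eq]
    congr 1
    funext x
    field_simp
  have fD : centredPeriod.indicator (periodize (deriv u)) =
      fun x => (L : ℂ) * centredPeriod.indicator (fun x =>
        1 * periodize (fun y => (L : ℂ)⁻¹ * deriv u y) x) x := by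
    rw [← indicator_const_mul_eq]
    congr 1
    funext x
    simp only [periodize, tsum_mul_left]
    field_simp
  have hA' : MemLp (centredPeriod.indicator (periodize u)) 2 volume := fA ▸ hA
  have hB' : MemLp (centredPeriod.indicator fun x : ℝ =>
      (Complex.exp (2 * Real.pi * Complex.I * x) - 1) * periodize u x) 2 volume :=
    fB ▸ hB.const_mul (L : ℂ)⁻¹
  have hD' : MemLp (centredPeriod.indicator (periodize (deriv u))) 2 volume :=
    fD ▸ hD.const_mul (L : ℂ)
  have gA : hA'.toLp _ = A := by rw [← eA, ← hA.toL2_eq, ← hA'.toL2_eq, fA]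
  have gB : hB'.toLp _ = ((L⁻¹ : ℝ) : ℂ) • B := by
    rw [← eB, ← hB.toL2_eq, ← hB'.toL2_eq, fB, toL2_const_mul hB, Complex.ofReal_inv]
  have gD : hD'.toLp _ = ((L⁻¹ : ℝ) : ℂ)⁻¹ • D := by
    rw [← eD, ← hD.toL2_eq, ← hD'.toL2_eq, fD, toL2_const_mul hD, Complex.ofReal_inv, inv_inv]
  have hA0 : 0 < ‖A‖ := norm_pos_iff.2 h0
  have hgram : ‖A‖ ^ 2 * ‖((L⁻¹ : ℝ) : ℂ) • B‖ ^ 2 - ‖inner ℂ A (((L⁻¹ : ℝ) : ℂ) • B)‖ ^ 2 =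
      (‖A‖ ^ 2 * ‖B‖ ^ 2 - ‖inner ℂ A B‖ ^ 2) * (L⁻¹) ^ 2 := by
    simp only [norm_smul, inner_smul_right, norm_mul, Complex.norm_real, Real.norm_eq_abs, mul_pow,
      sq_abs]
    ring
  have key := breitenbergerUC_eq hg hu hAC hu' hlim hA' hB' hD' (by rwa [gA]) (by
    rw [gA, gB, hgram]
    have h4 : 0 < ‖A‖ ^ 4 := by positivity
    have := mul_lt_mul_of_pos_right hV h4
    rw [one_mul] at this
    refine lt_of_eq_of_lt ?_ this
    field_simp)
  rw [gA, gB, gD, hgram, uncertainty_smul _ _ _ (inv_ne_zero hL.ne')] at key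
  rw [key]
  congr 4
  ring

end Scaled

/-! ### Rescaling the hypotheses and their integrability consequences -/

theorem ae_comp_mul_left {P : ℝ → Prop} (h : ∀ᵐ y, P y) {L : ℝ} (hL : L ≠ 0) :
    ∀ᵐ x, P (L * x) := by
  rw [ae_iff] at h ⊢
  have := Real.volume_preimage_mul_left hL {y | ¬ P y}
  rw [h, mul_zero] at this
  exact this

theorem rpow_neg_half_eq (j : ℕ) : (2 : ℝ) ^ (-(j : ℝ) / 2) = (√(2 ^ j))⁻¹ := by
  rw [Real.sqrt_eq_rpow, ← Real.rpow_natCast, ← Real.rpow_mul (by norm_num),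
    ← Real.rpow_neg (by norm_num)]
  congr 1
  ring

theorem norm_le_of_norm_rescale_le {j : ℕ} {g : ℝ → ℂ} {f : ℝ → ℝ}
    (h : ∀ x, ‖rescale j g x‖ ≤ f x) (x : ℝ) : ‖g x‖ ≤ √(2 ^ j) * f (2 ^ j * x) := by
  have h1 := h (2 ^ j * x)
  have e : 2 ^ j * x / 2 ^ j = x := by field_simp
  have h0 : 0 < √((2 : ℝ) ^ j) := by positivity
  rw [rescale, e, norm_mul, Complex.norm_real, rpow_neg_half_eq, Real.norm_of_nonneg (by positivity),
    inv_mul_le_iff₀ h0] at h1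
  exact h1

theorem deriv_rescale (j : ℕ) (g : ℝ → ℂ) (x : ℝ) :
    deriv (rescale j g) x =
      (((√(2 ^ j))⁻¹ * ((2 : ℝ) ^ j)⁻¹ : ℝ) : ℂ) * deriv g (x / 2 ^ j) := by
  have e : rescale j g = fun x => (((√(2 ^ j))⁻¹ : ℝ) : ℂ) * (fun y => g (((2 : ℝ) ^ j)⁻¹ * y)) x := by
    funext x
    rw [rescale, rpow_neg_half_eq]
    congr 2
    ring
  rw [e, deriv_const_mul_field, deriv_comp_mul_left, Complex.real_smul, ← mul_assoc, div_eq_inv_mul,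
    ← Complex.ofReal_mul]

theorem ae_norm_deriv_le_of_rescale {j : ℕ} {g : ℝ → ℂ} {f₁ : ℝ → ℝ}
    (h : ∀ᵐ x, ‖deriv (rescale j g) x‖ ≤ f₁ x) :
    ∀ᵐ x, ‖((2 : ℝ) ^ j : ℂ)⁻¹ * deriv g x‖ ≤ √(2 ^ j) * f₁ (2 ^ j * x) := by
  filter_upwards [ae_comp_mul_left h (L := 2 ^ j) (by positivity)] with x h1
  have e : 2 ^ j * x / 2 ^ j = x := by field_simp
  have h0 : 0 < √((2 : ℝ) ^ j) := by positivity
  rw [deriv_rescale, e, Complex.ofReal_mul, mul_assoc, norm_mul, Complex.norm_real,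
    Real.norm_of_nonneg (by positivity), inv_mul_le_iff₀ h0] at h1
  simpa using h1

theorem integrable_dilate {w : ℝ → ℝ} (hw : Integrable w) {L : ℝ} (hL : L ≠ 0) :
    Integrable fun x => √L * w (L * x) := (hw.comp_mul_left' hL).const_mul _

section Family

variable {ψ : ℕ → ℝ → ℂ} {f f₁ : ℝ → ℝ} {ε : ℝ}

/-- The hypotheses on the functions `ψ j` after rescaling to the original variable. -/
structure IsDominatedFamily (ψ : ℕ → ℝ → ℂ) (f f₁ : ℝ → ℝ) (ε : ℝ) : Prop where
  pos : 0 < ε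
  ac : ∀ j, LocallyAC (ψ j)
  memLp : MemLp f 2 volume
  memLp₁ : MemLp f₁ 2 volume
  bound : ∀ j, ∀ x, ‖ψ j x‖ ≤ √(2 ^ j) * f (2 ^ j * x)
  bound₁ : ∀ j, ∀ᵐ x, ‖((2 : ℝ) ^ j : ℂ)⁻¹ * deriv (ψ j) x‖ ≤ √(2 ^ j) * f₁ (2 ^ j * x)
  isBigO : f =O[cocompact ℝ] fun x => |x| ^ (-(3 / 2 + ε))
  isBigO₁ : f₁ =O[cocompact ℝ] fun x => |x| ^ (-(1 + ε))

namespace IsDominatedFamily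

variable (h : IsDominatedFamily ψ f f₁ ε)

include h

theorem integrable : Integrable f :=
  integrable_of_isBigO_abs_rpow (h.memLp.locallyIntegrable (by norm_num)) (by linarith [h.pos])
    h.isBigO

theorem integrable₁ : Integrable f₁ :=
  integrable_of_isBigO_abs_rpow (h.memLp₁.locallyIntegrable (by norm_num)) (by linarith [h.pos])
    h.isBigO₁

theorem isBigO_abs_rpow_mul (s : ℝ) :
    (fun x => |x| ^ s * f x) =O[cocompact ℝ] fun x => |x| ^ (-(3 / 2 + ε - s)) := by
  refine ((Asymptotics.isBigO_refl (fun x : ℝ => |x| ^ s) _).mul h.isBigO).congr' EventuallyEq.rfl ?_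
  filter_upwards [tendsto_norm_cocompact_atTop.eventually_gt_atTop 0] with x hx
  rw [Real.norm_eq_abs] at hx
  rw [← Real.rpow_add hx]
  congr 1
  ring

/-- With f of order |y|^(-3/2-ε), the square of |y|·f has order |y|^(-1-2ε). -/
theorem integrable_mul_sq : Integrable fun y => (2 * Real.pi * |y| * f y) ^ 2 := by
  have hli : LocallyIntegrable fun y => (2 * Real.pi * |y| * f y) ^ 2 := by
    have h1 : LocallyIntegrable fun y => f y ^ 2 := h.memLp.integrable_sq.locallyIntegrable
    have h2 : Continuous fun y : ℝ => (2 * Real.pi * |y|) ^ 2 := by fun_prop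
    have h3 := h1.locallyIntegrableOn Set.univ
    have h4 := h3.continuousOn_mul h2.continuousOn isOpen_univ.isLocallyClosed
    rw [locallyIntegrableOn_univ] at h4
    simpa only [mul_pow] using h4
  refine integrable_of_isBigO_abs_rpow hli (s := 1 + 2 * ε) (by linarith [h.pos]) ?_
  have h5 := ((h.isBigO_abs_rpow_mul 1).const_mul_left (2 * Real.pi)).pow 2
  refine h5.congr' (Eventually.of_forall fun x => by simp [mul_assoc]) ?_
  filter_upwards [tendsto_norm_cocompact_atTop.eventually_gt_atTop 0] with x hx
  rw [Real.norm_eq_abs] at hx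
  rw [← Real.rpow_natCast, ← Real.rpow_mul hx.le]
  congr 1
  push_cast
  ring

/-- Needed for a Hölder-1/2 bound on the Fourier transform at the origin. The weight |y| would give
a Lipschitz bound, but the decay assumption ensures its integrability only for ε > 1/2. -/
theorem integrable_sqrt_mul : Integrable fun y => √|y| * f y := by
  refine integrable_of_isBigO_abs_rpow (s := 1 + ε) ?_ (by linarith [h.pos]) ?_
  · have h2 : Continuous fun y : ℝ => √|y| := by fun_prop
    have h4 := ((h.integrable.locallyIntegrable).locallyIntegrableOn Set.univ).continuousOn_mul
      h2.continuousOn isOpen_univ.isLocallyClosed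
    rwa [locallyIntegrableOn_univ] at h4
  · have h5 := h.isBigO_abs_rpow_mul (1 / 2)
    simp only [← Real.sqrt_eq_rpow] at h5
    refine h5.congr_right fun x => ?_
    congr 1
    ring

theorem integrable_apply (j : ℕ) : Integrable (ψ j) :=
  (integrable_dilate h.integrable (by positivity)).mono'
    (h.ac j).continuous.aestronglyMeasurable (Eventually.of_forall (h.bound j))

theorem integrable_scaled_deriv (j : ℕ) :
    Integrable fun x => ((2 : ℝ) ^ j : ℂ)⁻¹ * deriv (ψ j) x :=
  (integrable_dilate h.integrable₁ (by positivity)).mono'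
    ((measurable_deriv _).const_mul _).aestronglyMeasurable (h.bound₁ j)

theorem integrable_deriv (j : ℕ) : Integrable (deriv (ψ j)) := by
  refine ((h.integrable_scaled_deriv j).const_mul ((2 : ℝ) ^ j : ℂ)).congr
    (Eventually.of_forall fun x => ?_)
  simp

theorem memLp_deriv (j : ℕ) : MemLp (deriv (ψ j)) 2 volume := by
  have h1 := memLp_two_of_norm_le_dilate (by positivity)
    (h.integrable_scaled_deriv j).aestronglyMeasurable h.memLp₁.integrable_sq (h.bound₁ j)
  refine (h1.const_mul ((2 : ℝ) ^ j : ℂ)).ae_eq (Eventually.of_forall fun x => ?_)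
  simp

theorem tendsto_zero (j : ℕ) : Tendsto (ψ j) (cocompact ℝ) (𝓝 0) := by
  have h1 : Tendsto f (cocompact ℝ) (𝓝 0) := by
    refine h.isBigO.trans_tendsto ?_
    have := (tendsto_rpow_neg_atTop (by linarith [h.pos] : 0 < 3 / 2 + ε)).comp
      (tendsto_norm_cocompact_atTop (E := ℝ))
    simpa [Function.comp_def] using this
  have h2 : Tendsto (fun x : ℝ => (2 : ℝ) ^ j * x) (cocompact ℝ) (cocompact ℝ) :=
    (Homeomorph.mulLeft₀ ((2 : ℝ) ^ j) (by positivity)).isClosedEmbedding.tendsto_cocompact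
  refine squeeze_zero_norm (h.bound j) ?_
  simpa using (h1.comp h2).const_mul (√(2 ^ j))

end IsDominatedFamily

end Family

/-! ### The exponential multiplier and the common limit -/

theorem norm_exp_two_pi_sub_one_le (x : ℝ) :
    ‖Complex.exp (2 * Real.pi * Complex.I * x) - 1‖ ≤ 2 * Real.pi * |x| := by
  have h := Real.norm_exp_I_mul_ofReal_sub_one_le (x := 2 * Real.pi * x)
  rw [show 2 * Real.pi * Complex.I * x = Complex.I * ((2 * Real.pi * x : ℝ) : ℂ) by
    push_cast; ring]
  refine h.trans_eq ?_
  rw [norm_mul, Real.norm_of_nonneg (by positivity), Real.norm_eq_abs]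

/-- The sequence consists of difference quotients at 0 of t ↦ e^{2πiyt} with steps 2^(-j). -/
theorem tendsto_dilated_exp_sub_one (y : ℝ) :
    Tendsto (fun j : ℕ => (2 ^ j : ℂ) *
      (Complex.exp (2 * Real.pi * Complex.I * ((y / 2 ^ j : ℝ) : ℂ)) - 1)) atTop
      (𝓝 (2 * Real.pi * Complex.I * y)) := by
  have hd : HasDerivAt (fun t : ℝ => Complex.exp (2 * Real.pi * Complex.I * y * t))
      (2 * Real.pi * Complex.I * y) 0 := by
    have h1 : HasDerivAt (fun t : ℝ => 2 * Real.pi * Complex.I * y * (t : ℂ))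
        (2 * Real.pi * Complex.I * y) 0 := by
      simpa using (Complex.ofRealCLM.hasDerivAt (x := (0 : ℝ))).const_mul
        (2 * Real.pi * Complex.I * y)
    simpa using h1.cexp
  have h2 := hd.tendsto_slope_zero
  have h3 : Tendsto (fun j : ℕ => ((2 : ℝ) ^ j)⁻¹) atTop (𝓝[≠] 0) := by
    refine tendsto_nhdsWithin_iff.2 ⟨tendsto_inv_atTop_zero.comp
      (tendsto_pow_atTop_atTop_of_one_lt one_lt_two), Eventually.of_forall fun j => ?_⟩
    simp
  refine (h2.comp h3).congr fun j => ?_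
  simp only [Function.comp_apply, inv_inv, zero_add, Complex.ofReal_zero, mul_zero,
    Complex.exp_zero, Complex.real_smul]
  push_cast
  congr 3
  ring

theorem tendsto_const_mul_sqrt_mul_rpow {s β : ℝ} (hβ : s + 1 / 2 < β) (K : ℝ) :
    Tendsto (fun j : ℕ => (K * ((2 : ℝ) ^ j) ^ s) * (√(2 ^ j) * (2 ^ j) ^ (-β))) atTop (𝓝 0) := by
  have h1 : Tendsto (fun j : ℕ => (2 : ℝ) ^ j) atTop atTop :=
    tendsto_pow_atTop_atTop_of_one_lt one_lt_two
  have h2 := ((tendsto_rpow_neg_atTop (by linarith : 0 < β - (s + 1 / 2))).comp h1).const_mul K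
  rw [mul_zero] at h2
  refine h2.congr fun j => ?_
  have h0 : (0 : ℝ) < 2 ^ j := by positivity
  rw [Function.comp_apply, Real.sqrt_eq_rpow, ← Real.rpow_add h0, mul_assoc, ← Real.rpow_add h0]
  congr 2
  ring

namespace IsDominatedFamily

variable {ψ : ℕ → ℝ → ℂ} {f f₁ : ℝ → ℝ} {ε : ℝ}

/-- Along every ultrafilter on which the norms do not degenerate, the Breitenberger constants of
the periodizations and the Heisenberg constants have a common finite limit. -/
theorem exists_common_limit (h : IsDominatedFamily ψ f f₁ ε) (hψ : ∀ j, MemLp (ψ j) 2 volume)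
    {g : ℕ → UnitAddCircle → ℂ}
    (hg : ∀ j, ∀ᵐ x : ℝ, g j (x : UnitAddCircle) = ∑' n : ℤ, ψ j (x - n))
    (U : Ultrafilter ℕ) (hU : ↑U ≤ (atTop : Filter ℕ)) {c : ℝ} (hc : 0 < c)
    (hnorm : ∀ᶠ j in U, c ≤ ‖(hψ j).toLp (ψ j)‖) :
    ∃ G : ℝ≥0∞, G ≠ ∞ ∧ Tendsto (fun j => breitenbergerUC (g j)) U (𝓝 G) ∧
      Tendsto (fun j => heisenbergUC (ψ j) (hψ j)) U (𝓝 G) := by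
  have hε := h.pos
  obtain ⟨C, Y, hC, hY, hFd⟩ := exists_bound_of_isBigO_abs_rpow h.isBigO
  obtain ⟨C₁, Y₁, hC₁, hY₁, hFd₁⟩ := exists_bound_of_isBigO_abs_rpow h.isBigO₁
  have hM0 : ∀ {β : ℝ}, 1 < β →
      Tendsto (fun j : ℕ => (1 : ℝ) * (√(2 ^ j) * (2 ^ j) ^ (-β))) atTop (𝓝 0) := fun hβ => by
    simpa using tendsto_const_mul_sqrt_mul_rpow (s := 0) (by linarith) 1
  have hW : Integrable fun y => ((fun _ => (1 : ℝ)) y * f y) ^ 2 := by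
    simpa using h.memLp.integrable_sq
  have hW₁ : Integrable fun y => ((fun _ => (1 : ℝ)) y * f₁ y) ^ 2 := by
    simpa using h.memLp₁.integrable_sq
  obtain ⟨mA, tA⟩ := tendsto_toL2_periodize (m := fun _ => 1) (mj := fun _ _ => 1)
    (W := fun _ => 1) (M := fun _ => 1) (by linarith) hC hFd h.memLp.aestronglyMeasurable
    h.integrable_apply (fun j => Eventually.of_forall (h.bound j)) hW continuous_const
    (fun _ => continuous_const) (by simp) (by simp) (fun _ => tendsto_const_nhds) (by simp)
    (hM0 (by linarith))
  obtain ⟨mD, tD⟩ := tendsto_toL2_periodize (m := fun _ => 1) (mj := fun _ _ => 1)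
    (W := fun _ => 1) (M := fun _ => 1) (by linarith) hC₁ hFd₁ h.memLp₁.aestronglyMeasurable
    h.integrable_scaled_deriv h.bound₁ hW₁ continuous_const
    (fun _ => continuous_const) (by simp) (by simp) (fun _ => tendsto_const_nhds) (by simp)
    (hM0 (by linarith))
  have hmB : Continuous fun y : ℝ => (2 * Real.pi * Complex.I * y : ℂ) := by fun_prop
  have hmB' : ∀ y : ℝ, ‖(2 * Real.pi * Complex.I * y : ℂ)‖ ≤ 2 * Real.pi * |y| := fun y => by
    simp [abs_of_pos Real.pi_pos]
  -- The multiplier has supremum at most 2·2^j, so the tail contributes O(2^(j(3/2-β))). With β =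
  -- 3/2 + ε this tends to zero.
  obtain ⟨mB, tB⟩ := tendsto_toL2_periodize (v := ψ) (m := fun y => 2 * Real.pi * Complex.I * y)
    (mj := fun j x => (((2 : ℝ) ^ j : ℝ) : ℂ) * (Complex.exp (2 * Real.pi * Complex.I * x) - 1))
    (W := fun y => 2 * Real.pi * |y|) (M := fun j => 2 * ((2 : ℝ) ^ j) ^ (1 : ℝ))
    (by linarith) hC hFd h.memLp.aestronglyMeasurable
    h.integrable_apply (fun j => Eventually.of_forall (h.bound j)) h.integrable_mul_sq hmB
    (fun j => by fun_prop) hmB'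
    (fun j y => by
      rw [norm_mul, Complex.norm_real, Real.norm_of_nonneg (by positivity)]
      calc _ ≤ 2 ^ j * (2 * Real.pi * |y / 2 ^ j|) := by
            gcongr; exact norm_exp_two_pi_sub_one_le _
        _ = _ := by rw [abs_div, abs_of_pos (by positivity : (0 : ℝ) < 2 ^ j)]; field_simp)
    (fun y => by simpa using tendsto_dilated_exp_sub_one y)
    (fun j x => by
      rw [norm_mul, Complex.norm_real, Real.norm_of_nonneg (by positivity), Real.rpow_one, mul_comm]
      gcongr
      refine (norm_sub_le _ _).trans ?_
      rw [norm_exp_two_pi, norm_one]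
      norm_num)
    (tendsto_const_mul_sqrt_mul_rpow (by linarith) 2)
  have bA := fun j => memLp_multiplier (m := fun _ => 1) (W := fun _ => 1) h.integrable_apply
    (fun j => Eventually.of_forall (h.bound j)) hW continuous_const (by simp) j
  have bD := fun j => memLp_multiplier (m := fun _ => 1) (W := fun _ => 1)
    h.integrable_scaled_deriv h.bound₁ hW₁ continuous_const (by simp) j
  have bB := fun j => memLp_multiplier (v := ψ) (m := fun y => 2 * Real.pi * Complex.I * y)
    (W := fun y => 2 * Real.pi * |y|) h.integrable_apply
    (fun j => Eventually.of_forall (h.bound j)) h.integrable_mul_sq hmB hmB' j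
  have eA : ∀ j, toL2 (fun x => 1 * ψ j x) = (hψ j).toLp (ψ j) := fun j => by
    simp only [one_mul]; exact (hψ j).toL2_eq
  obtain ⟨G, R, α, hα, lα, lG, lG', lR⟩ := exists_tendsto_uncertainty U (tA.mono_left hU)
    (tB.mono_left hU) (tD.mono_left hU) (fun j => (bA j).2) (fun j => (bB j).2)
    (fun j => (bD j).2) hc (hnorm.mono fun j hj => by rw [eA]; exact hj)
  have hpow : Tendsto (fun j : ℕ => (2 : ℝ) ^ j) atTop atTop :=
    tendsto_pow_atTop_atTop_of_one_lt one_lt_two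
  -- The normalized Gram determinant converges along `U`, so its product with 4^(-j) vanishes and
  -- the Breitenberger denominator tends to 1.
  have lR0 := lR.mul (((tendsto_inv_atTop_zero.comp hpow).mono_left hU).pow 2)
  simp only [Function.comp_apply, ne_eq, OfNat.ofNat_ne_zero, not_false_eq_true, zero_pow,
    mul_zero] at lR0
  have lB := lG.div (tendsto_const_nhds.sub lR0) (by norm_num : (1 : ℝ) - 0 ≠ 0)
  rw [sub_zero, div_one] at lB
  have cont : ∀ {s : ℕ → ℝ}, Tendsto s U (𝓝 G) →
      Tendsto (fun j => ENNReal.ofReal (s j) ^ (1 / 2 : ℝ)) U (𝓝 (ENNReal.ofReal G ^ (1 / 2 : ℝ))) :=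
    fun hs => (ENNReal.continuous_rpow_const.tendsto _).comp (ENNReal.tendsto_ofReal hs)
  refine ⟨ENNReal.ofReal G ^ (1 / 2 : ℝ),
    ENNReal.rpow_ne_top_of_nonneg (by norm_num) ENNReal.ofReal_ne_top, ?_, ?_⟩
  · refine (cont lB).congr' ?_
    filter_upwards [hU mA, hU mB, hU mD, lα.eventually_const_lt hα, lR0.eventually_lt_const
      one_pos] with j hA hB hD hα hV
    refine (breitenbergerUC_eq_dilated (L := 2 ^ j) (by positivity) (hg j) (h.integrable_apply j)
      (h.ac j) (h.integrable_deriv j) (h.tendsto_zero j) hA hB (by simpa using hD) hA.toL2_eq.symm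
      hB.toL2_eq.symm (by rw [← MemLp.toL2_eq]; push_cast; rfl) (norm_pos_iff.1 hα) hV).symm
  · refine (cont lG').congr' ?_
    filter_upwards [hnorm] with j hj
    have hx : MemLp (fun x : ℝ => 2 * Real.pi * Complex.I * x * ψ j x) 2 volume := by
      refine ((bB j).1.const_mul ((2 : ℝ) ^ j : ℂ)⁻¹).ae_eq (Eventually.of_forall fun x => ?_)
      push_cast
      field_simp
    rw [heisenbergUC_eq_dilated (L := 2 ^ j) (by positivity) (hψ j) (h.ac j) (h.integrable_apply j)
      (h.integrable_deriv j) (h.memLp_deriv j) hx (h.tendsto_zero j)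
      (norm_pos_iff.1 (hc.trans_le hj))]
    push_cast
    rfl

end IsDominatedFamily

/-! ### Nondegeneracy of the norms from the frame identity -/

theorem norm_inner_fourierLp {v : UnitAddCircle → ℂ} (hv : MemLp v 2 AddCircle.haarAddCircle)
    (n : ℤ) : ‖inner ℂ (hv.toLp v) (fourierLp 2 n)‖ = ‖fourierCoeff v n‖ := by
  rw [norm_inner_symm, ← coe_fourierBasis, ← HilbertBasis.repr_apply_apply, fourierBasis_repr,
    fourierCoeff_congr_ae hv.coeFn_toLp]

/-- A translation multiplies each coefficient by a unimodular number, so all 2^j translates at level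
j contribute equally to the frame sum. -/
theorem norm_fourierCoeff_comp_sub (g : UnitAddCircle → ℂ) (a : UnitAddCircle) (n : ℤ) :
    ‖fourierCoeff (fun x => g (x - a)) n‖ = ‖fourierCoeff g n‖ := by
  have h : fourierCoeff (fun x => g (x - a)) n = fourier (-n) a * fourierCoeff g n := by
    unfold fourierCoeff
    rw [← integral_sub_right_eq_self (fun t => fourier (-n) t • g t) a, ← integral_const_mul]
    refine integral_congr_ae (Eventually.of_forall fun x => ?_)
    have e : fourier (-n) x = fourier (-n) a * fourier (-n) (x - a) := by
      simp only [fourier_apply, ← Circle.coe_mul, ← AddCircle.toCircle_add, ← smul_add,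
        add_sub_cancel]
    simp only [smul_eq_mul, e]
    ring
  rw [h, norm_mul, fourier_apply, Circle.norm_coe, one_mul]

/-- The Parseval identity for a periodic system, applied to an exponential. -/
theorem IsParsevalFrameOfFunctions.hasSum_fourierCoeff_sq {φ : UnitAddCircle → ℂ}
    {g : ℕ → UnitAddCircle → ℂ}
    (hP : IsParsevalFrameOfFunctions AddCircle.haarAddCircle (periodicSystem φ g)) (n : ℤ) :
    HasSum (fun j : ℕ => 2 ^ j * ‖fourierCoeff (g j) n‖ ^ 2) (1 - ‖fourierCoeff φ n‖ ^ 2) := by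
  obtain ⟨hm, hf⟩ := hP
  have h := hf (fourierLp 2 n)
  rw [orthonormal_fourier.1 n, one_pow] at h
  simp only [norm_inner_fourierLp] at h
  have h2 := (h.summable.comp_injective Sum.inr_injective).hasSum
  have h3 : HasSum (fun i : Unit ⊕ (Σ j : ℕ, Fin (2 ^ j)) =>
      ‖fourierCoeff (periodicSystem φ g i) n‖ ^ 2) _ :=
    HasSum.sum (f := fun i => ‖fourierCoeff (periodicSystem φ g i) n‖ ^ 2)
      (hasSum_fintype _) h2
  have h4 := h.unique h3
  have h5 := h2.sigma (fun j => hasSum_fintype _)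
  simp only [Function.comp_apply, periodicSystem, norm_fourierCoeff_comp_sub, Finset.sum_const,
    Finset.card_univ, Fintype.card_fin, nsmul_eq_mul] at h5
  simp only [Function.comp_apply, periodicSystem, norm_fourierCoeff_comp_sub, Finset.univ_unique,
    Finset.sum_singleton] at h4
  rw [← sub_eq_of_eq_add' h4] at h5
  simpa using h5

theorem tendsto_fourierCoeff_cofinite {v : UnitAddCircle → ℂ}
    (hv : MemLp v 2 AddCircle.haarAddCircle) :
    Tendsto (fun n : ℤ => ‖fourierCoeff v n‖ ^ 2) cofinite (𝓝 0) := by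
  have h := (hasSum_sq_fourierCoeff (hv.toLp v)).summable.tendsto_cofinite_zero
  simpa only [fourierCoeff_congr_ae hv.coeFn_toLp] using h

/-- Tannery's theorem for the dilations by powers of two of a sequence of functions which tend to
zero uniformly, decay at infinity and have square summable values at the origin. -/
theorem tendsto_tsum_sq_dyadic {a : ℕ → ℕ → ℝ} {a₀ b : ℕ → ℝ} {K₁ K₂ : ℝ}
    (ha : ∀ j m, 0 ≤ a j m) (hab : ∀ j m, a j m ≤ b j) (hab₀ : ∀ j, |a₀ j| ≤ b j)
    (hb : Tendsto b atTop (𝓝 0)) (hK₁ : ∀ j m, a j m ≤ K₁ * (2 ^ j / 2 ^ m))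
    (hK₂ : ∀ j m, |a j m - a₀ j| ≤ K₂ * √(2 ^ m / 2 ^ j))
    (h₀ : Summable fun j => a₀ j ^ 2) (hs : ∀ m, Summable fun j => a j m ^ 2) :
    Tendsto (fun m => ∑' j, a j m ^ 2) atTop (𝓝 0) := by
  -- Levels j < m: with i = m - 1 - j, the term is at most (K₁·2^(-i-1))², a geometric majorant in
  -- i, and for fixed i it tends to zero through `b`.
  have hlow : Tendsto (fun m => ∑ j ∈ Finset.range m, a j m ^ 2) atTop (𝓝 0) := by
    have e : ∀ m, ∑ j ∈ Finset.range m, a j m ^ 2 =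
        ∑' i, if i < m then a (m - 1 - i) m ^ 2 else 0 := fun m => by
      rw [← Finset.sum_range_reflect (fun j => a j m ^ 2),
        tsum_eq_sum (s := Finset.range m) (fun i hi => by simp_all)]
      exact Finset.sum_congr rfl fun i hi => by rw [if_pos (Finset.mem_range.1 hi)]
    simp_rw [e]
    have hg : Summable fun i : ℕ => K₁ ^ 2 * (1 / 4 : ℝ) ^ i :=
      (summable_geometric_of_lt_one (by norm_num) (by norm_num)).mul_left _
    suffices Tendsto (fun m => ∑' i, if i < m then a (m - 1 - i) m ^ 2 else 0) atTop
        (𝓝 (∑' _ : ℕ, (0 : ℝ))) by simpa only [tsum_zero] using this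
    refine tendsto_tsum_of_dominated_convergence hg (fun i => ?_) (Eventually.of_forall fun m i => ?_)
    · have h1 : Tendsto (fun m => b (m - 1 - i) ^ 2) atTop (𝓝 0) := by
        have := (hb.comp ((tendsto_sub_atTop_nat i).comp (tendsto_sub_atTop_nat 1))).pow 2
        simpa using this
      refine squeeze_zero (fun m => by split_ifs <;> positivity) (fun m => ?_) h1
      split_ifs
      · have := ha (m - 1 - i) m
        gcongr
        exact hab _ _
      · positivity
    · split_ifs with him
      · rw [Real.norm_of_nonneg (by positivity)]
        have h1 := hK₁ (m - 1 - i) m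
        have h2 : (2 : ℝ) ^ (m - 1 - i) / 2 ^ m = 1 / 2 * (1 / 2) ^ i := by
          obtain ⟨k, rfl⟩ : ∃ k, m = k + 1 + i := ⟨m - 1 - i, by omega⟩
          rw [show k + 1 + i - 1 - i = k by omega, one_div_pow, pow_add, pow_succ]
          field_simp
        have h3 := ha (m - 1 - i) m
        rw [h2] at h1
        calc _ ≤ (K₁ * (1 / 2 * (1 / 2) ^ i)) ^ 2 := by gcongr
          _ = (1 / 4) * (K₁ ^ 2 * (1 / 4) ^ i) := by
              rw [mul_pow, mul_pow, ← pow_mul, mul_comm i 2, pow_mul]; norm_num; ring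
          _ ≤ _ := by nlinarith [show 0 ≤ K₁ ^ 2 * (1 / 4 : ℝ) ^ i by positivity]
      · rw [norm_zero]; positivity
  -- Levels j = i + m ≥ m: the squared difference from a₀ is at most K₂²·2^(-i). The values a₀
  -- themselves contribute only a tail of a convergent series.
  have hdiff : Tendsto (fun m => ∑' i, (a (i + m) m - a₀ (i + m)) ^ 2) atTop (𝓝 0) ∧
      ∀ m, Summable fun i => (a (i + m) m - a₀ (i + m)) ^ 2 := by
    have hg : Summable fun i : ℕ => K₂ ^ 2 * (1 / 2 : ℝ) ^ i :=
      (summable_geometric_of_lt_one (by norm_num) (by norm_num)).mul_left _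
    have hle : ∀ m i, ‖(a (i + m) m - a₀ (i + m)) ^ 2‖ ≤ K₂ ^ 2 * (1 / 2 : ℝ) ^ i := fun m i => by
      have h1 := hK₂ (i + m) m
      rw [norm_pow, Real.norm_eq_abs]
      calc _ ≤ (K₂ * √(2 ^ m / 2 ^ (i + m))) ^ 2 := by gcongr
        _ = _ := by
          rw [mul_pow, Real.sq_sqrt (by positivity), pow_add, one_div_pow]
          field_simp
    refine ⟨?_, fun m => Summable.of_norm_bounded hg (hle m)⟩
    suffices Tendsto (fun m => ∑' i, (a (i + m) m - a₀ (i + m)) ^ 2) atTop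
        (𝓝 (∑' _ : ℕ, (0 : ℝ))) by simpa only [tsum_zero] using this
    refine tendsto_tsum_of_dominated_convergence hg (fun i => ?_) (Eventually.of_forall hle)
    have h1 : Tendsto (fun m => (2 * b (i + m)) ^ 2) atTop (𝓝 0) := by
      have h2 : Tendsto (fun m => i + m) atTop atTop := 
        tendsto_atTop_mono (fun m => Nat.le_add_left m i) tendsto_id
      simpa using ((hb.comp h2).const_mul 2).pow 2
    refine squeeze_zero (fun m => sq_nonneg _) (fun m => ?_) h1
    refine sq_le_sq' ?_ ?_ <;>
      linarith [ha (i + m) m, hab (i + m) m, hab₀ (i + m), (abs_le.1 (hab₀ (i + m))).1,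
        (abs_le.1 (hab₀ (i + m))).2]
  have htail : Tendsto (fun m => ∑' i, a₀ (i + m) ^ 2) atTop (𝓝 0) :=
    tendsto_sum_nat_add fun j => a₀ j ^ 2
  have hbound := (hlow.add ((htail.const_mul 2).add (hdiff.1.const_mul 2)))
  simp only [mul_zero, add_zero] at hbound
  refine squeeze_zero (fun m => tsum_nonneg fun j => sq_nonneg _) (fun m => ?_) hbound
  rw [← (hs m).sum_add_tsum_nat_add m]
  have hs0 : Summable fun i => a₀ (i + m) ^ 2 := (summable_nat_add_iff m).2 h₀
  gcongr
  rw [← tsum_mul_left, ← tsum_mul_left, ← (hs0.mul_left 2).tsum_add ((hdiff.2 m).mul_left 2)]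
  refine ((summable_nat_add_iff m).2 (hs m)).tsum_le_tsum (fun i => ?_)
    ((hs0.mul_left 2).add ((hdiff.2 m).mul_left 2))
  -- 2a₀² + 2(a - a₀)² - a² = (a - 2a₀)².
  nlinarith [sq_nonneg (a (i + m) m - 2 * a₀ (i + m))]

theorem norm_fourier_le_integral (u : ℝ → ℂ) (ξ : ℝ) : ‖𝓕 u ξ‖ ≤ ∫ x, ‖u x‖ :=
  VectorFourier.norm_fourierIntegral_le_integral_norm _ _ _ _ _

/-- Geometric mean of the bounds |x| and 2. -/
theorem norm_exp_sub_one_le_sqrt (x : ℝ) :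
    ‖Complex.exp ((x : ℂ) * Complex.I) - 1‖ ≤ √(2 * |x|) := by
  have h1 : ‖Complex.exp ((x : ℂ) * Complex.I) - 1‖ ≤ |x| := by
    rw [mul_comm, ← Real.norm_eq_abs]; exact Real.norm_exp_I_mul_ofReal_sub_one_le
  have h2 : ‖Complex.exp ((x : ℂ) * Complex.I) - 1‖ ≤ 2 := by
    refine (norm_sub_le _ _).trans ?_
    rw [Complex.norm_exp_ofReal_mul_I, norm_one]; norm_num
  refine Real.le_sqrt_of_sq_le ?_
  rw [sq]
  exact mul_le_mul h2 h1 (norm_nonneg _) (by norm_num)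

theorem tendsto_integral_min_inv {f : ℝ → ℝ} (hf : Integrable f) (h0 : ∀ y, 0 ≤ f y) :
    Tendsto (fun n : ℕ => ∫ y, min (f y) (1 / ((n : ℝ) + 1))) atTop (𝓝 0) := by
  have hn : ∀ n : ℕ, (0 : ℝ) ≤ 1 / ((n : ℝ) + 1) := fun n => by positivity
  have := tendsto_integral_of_dominated_convergence (f := fun _ => 0)
    (F := fun (n : ℕ) y => min (f y) (1 / ((n : ℝ) + 1))) f
    (fun n => hf.aestronglyMeasurable.inf aestronglyMeasurable_const) hf
    (fun n => Eventually.of_forall fun y => by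
      rw [Real.norm_of_nonneg (le_min (h0 y) (hn n))]; exact min_le_left _ _)
    (Eventually.of_forall fun y => squeeze_zero (fun n => le_min (h0 y) (hn n))
      (fun n => min_le_right _ _) tendsto_one_div_add_atTop_nhds_zero_nat)
  simpa using this

namespace IsDominatedFamily

variable {ψ : ℕ → ℝ → ℂ} {f f₁ : ℝ → ℝ} {ε : ℝ} (h : IsDominatedFamily ψ f f₁ ε)

include h

theorem nonneg (y : ℝ) : 0 ≤ f y := by
  have h1 := (norm_nonneg _).trans (h.bound 0 y)
  simpa using h1

/-- The quantity is the L¹ norm of the rescaled function. Domination by the integrable f makes L²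
convergence to zero imply L¹ convergence: large values are controlled by the square, small ones by a
truncation of f. -/
theorem tendsto_sqrt_mul_integral_norm (hψ : ∀ j, MemLp (ψ j) 2 volume)
    (hz : Tendsto (fun j => ‖(hψ j).toLp (ψ j)‖) atTop (𝓝 0)) :
    Tendsto (fun j : ℕ => √(2 ^ j) * ∫ x, ‖ψ j x‖) atTop (𝓝 0) := by
  have hkey : ∀ (n j : ℕ), √(2 ^ j) * ∫ x, ‖ψ j x‖ ≤
      ((n : ℝ) + 1) * ‖(hψ j).toLp (ψ j)‖ ^ 2 + ∫ y, min (f y) (1 / ((n : ℝ) + 1)) := fun n j => by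
    have hL : (0 : ℝ) < 2 ^ j := by positivity
    have hmin : Integrable fun y => min (f y) (1 / ((n : ℝ) + 1)) :=
      h.integrable.mono' (h.integrable.aestronglyMeasurable.inf aestronglyMeasurable_const)
        (Eventually.of_forall fun y => by
          rw [Real.norm_of_nonneg (le_min (h.nonneg y) (by positivity))]; exact min_le_left _ _)
    have e : ∫ y, min (f y) (1 / ((n : ℝ) + 1)) =
        ∫ x, (2 : ℝ) ^ j * min (f (2 ^ j * x)) (1 / ((n : ℝ) + 1)) := by
      rw [integral_const_mul,
        Measure.integral_comp_mul_left (fun y => min (f y) (1 / ((n : ℝ) + 1))),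
        abs_of_pos (by positivity), smul_eq_mul]
      field_simp
    have hi1 := (hψ j).norm.integrable_sq.const_mul ((n : ℝ) + 1)
    have hi2 : Integrable fun x => (2 : ℝ) ^ j * min (f (2 ^ j * x)) (1 / ((n : ℝ) + 1)) :=
      (hmin.comp_mul_left' hL.ne').const_mul _
    rw [norm_toLp_sq, e, ← integral_const_mul, ← integral_const_mul, ← integral_add hi1 hi2]
    refine integral_mono ((h.integrable_apply j).norm.const_mul _) (hi1.add hi2) fun x => ?_
    have hs : 0 < √((2 : ℝ) ^ j) := by positivity
    have hss : √((2 : ℝ) ^ j) * √(2 ^ j) = 2 ^ j := Real.mul_self_sqrt hL.le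
    obtain ⟨p, hp⟩ : ∃ p, ‖ψ j x‖ = √(2 ^ j) * p := ⟨‖ψ j x‖ / √(2 ^ j), by field_simp⟩
    have hpf : p ≤ f (2 ^ j * x) := le_of_mul_le_mul_left (hp ▸ h.bound j x) hs
    have hp0 : 0 ≤ p := by
      have := norm_nonneg (ψ j x); rw [hp] at this; exact nonneg_of_mul_nonneg_right this hs
    have hn : (0 : ℝ) < (n : ℝ) + 1 := by positivity
    -- Split at p = 1/(n+1): below it p is bounded by the minimum, above it by (n+1)·p².
    have hmain : p ≤ ((n : ℝ) + 1) * p ^ 2 + min (f (2 ^ j * x)) (1 / ((n : ℝ) + 1)) := by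
      rcases le_total p (1 / ((n : ℝ) + 1)) with h1 | h1
      · have := le_min hpf h1
        nlinarith [mul_nonneg hn.le (sq_nonneg p)]
      · have h2 : 1 ≤ ((n : ℝ) + 1) * p := by rw [div_le_iff₀ hn] at h1; linarith
        have h3 : 0 ≤ min (f (2 ^ j * x)) (1 / ((n : ℝ) + 1)) :=
          le_min (h.nonneg _) (by positivity)
        nlinarith
    simp only [hp]
    calc _ = 2 ^ j * p := by rw [← mul_assoc, hss]
      _ ≤ 2 ^ j * (((n : ℝ) + 1) * p ^ 2 + min (f (2 ^ j * x)) (1 / ((n : ℝ) + 1))) := by gcongr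
      _ = _ := by rw [mul_pow, Real.sq_sqrt hL.le]; ring
  rw [Metric.tendsto_atTop]
  intro δ hδ
  obtain ⟨n, hn⟩ := ((tendsto_integral_min_inv h.integrable h.nonneg).eventually_lt_const
    (half_pos hδ)).exists
  have h2 : Tendsto (fun j => ((n : ℝ) + 1) * ‖(hψ j).toLp (ψ j)‖ ^ 2) atTop (𝓝 0) := by
    simpa using (hz.pow 2).const_mul ((n : ℝ) + 1)
  obtain ⟨N, hN⟩ := eventually_atTop.1 (h2.eventually_lt_const (half_pos hδ))
  refine ⟨N, fun j hj => ?_⟩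
  have h3 : 0 ≤ √((2 : ℝ) ^ j) * ∫ x, ‖ψ j x‖ :=
    mul_nonneg (Real.sqrt_nonneg _) (integral_nonneg fun x => norm_nonneg _)
  rw [dist_zero_right, Real.norm_of_nonneg h3]
  linarith [hkey n j, hN j hj]

/-- One derivative costs a factor 2^j in L¹ and gains 2πξ on the Fourier side. This controls the
levels j < m at frequency 2^m. -/
theorem sqrt_mul_norm_fourier_le (j : ℕ) {ξ : ℝ} (hξ : 0 < ξ) :
    √(2 ^ j) * ‖𝓕 (ψ j) ξ‖ ≤ (∫ y, f₁ y) / (2 * Real.pi) * (2 ^ j / ξ) := by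
  have hpi := Real.pi_pos
  have hL : (0 : ℝ) < 2 ^ j := by positivity
  have h1 := congrArg norm (fourier_deriv_of_locallyAC (h.ac j) (h.integrable_apply j)
    (h.integrable_deriv j) (h.tendsto_zero j) ξ)
  have h2 : ‖𝓕 (deriv (ψ j)) ξ‖ ≤ ∫ x, ‖deriv (ψ j) x‖ :=
    norm_fourier_le_integral _ _
  have h3 : ∫ x, ‖deriv (ψ j) x‖ ≤ ∫ x, 2 ^ j * (√(2 ^ j) * f₁ (2 ^ j * x)) := by
    refine integral_mono_ae (h.integrable_deriv j).norm
      ((integrable_dilate h.integrable₁ hL.ne').const_mul _) ?_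
    filter_upwards [h.bound₁ j] with x hx
    rw [norm_mul, norm_inv, norm_pow, Complex.norm_real, Real.norm_of_nonneg (by norm_num),
      inv_mul_le_iff₀ hL] at hx
    exact hx
  rw [integral_const_mul, integral_const_mul, Measure.integral_comp_mul_left f₁,
    abs_of_pos (by positivity), smul_eq_mul] at h3
  simp only [norm_mul, Complex.norm_ofNat, Complex.norm_real, Complex.norm_I, Real.norm_eq_abs,
    abs_of_pos hpi, abs_of_pos hξ, mul_one] at h1
  have h4 := h2.trans h3
  rw [h1] at h4
  have hss : √((2 : ℝ) ^ j) * √(2 ^ j) = 2 ^ j := Real.mul_self_sqrt hL.le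
  have h5 := mul_le_mul_of_nonneg_left h4 (Real.sqrt_nonneg ((2 : ℝ) ^ j))
  have h6 : √((2 : ℝ) ^ j) * (2 ^ j * (√(2 ^ j) * ((2 ^ j)⁻¹ * ∫ y, f₁ y))) =
      2 ^ j * ∫ y, f₁ y := by
    calc _ = √((2 : ℝ) ^ j) * √(2 ^ j) * (2 ^ j * (2 ^ j)⁻¹) * ∫ y, f₁ y := by ring
      _ = _ := by rw [hss, mul_inv_cancel₀ hL.ne', mul_one]
  rw [h6] at h5
  rw [div_mul_div_comm, le_div_iff₀ (by positivity)]
  linarith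

/-- Hölder-1/2 continuity at the origin on the frequency scale 2^j, from |e^{it} - 1| ≤ √(2|t|).
This controls the levels j ≥ m at frequency 2^m. -/
theorem abs_sqrt_mul_norm_fourier_sub_le (j : ℕ) {ξ : ℝ} (hξ : 0 ≤ ξ) :
    |√(2 ^ j) * ‖𝓕 (ψ j) ξ‖ - √(2 ^ j) * ‖𝓕 (ψ j) 0‖| ≤
      (√(4 * Real.pi) * ∫ y, √|y| * f y) * √(ξ / 2 ^ j) := by
  have hpi := Real.pi_pos
  have hL : (0 : ℝ) < 2 ^ j := by positivity
  have hs : 0 < √((2 : ℝ) ^ j) := by positivity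
  have hi : ∀ ξ : ℝ, Integrable fun x => Complex.exp (((-2 * Real.pi * x * ξ : ℝ) : ℂ) * Complex.I) *
      ψ j x := fun ξ =>
    (h.integrable_apply j).bdd_mul (c := 1) (Continuous.aestronglyMeasurable (by fun_prop))
      (Eventually.of_forall fun x => (Complex.norm_exp_ofReal_mul_I _).le)
  have h1 : 𝓕 (ψ j) ξ - 𝓕 (ψ j) 0 =
      ∫ x, (Complex.exp (((-2 * Real.pi * x * ξ : ℝ) : ℂ) * Complex.I) - 1) * ψ j x := by
    simp only [Real.fourier_real_eq_integral_exp_smul, smul_eq_mul]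
    rw [← integral_sub (hi ξ) (hi 0)]
    refine integral_congr_ae (Eventually.of_forall fun x => ?_)
    simp [sub_mul]
  have hdom : Integrable fun x => √(4 * Real.pi * ξ / 2 ^ j) * (√(2 ^ j) *
      (fun y => √|y| * f y) (2 ^ j * x)) :=
    (integrable_dilate h.integrable_sqrt_mul hL.ne').const_mul _
  have h2 : ‖𝓕 (ψ j) ξ - 𝓕 (ψ j) 0‖ ≤ ∫ x, √(4 * Real.pi * ξ / 2 ^ j) * (√(2 ^ j) *
      (fun y => √|y| * f y) (2 ^ j * x)) := by
    rw [h1]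
    refine norm_integral_le_of_norm_le hdom (Eventually.of_forall fun x => ?_)
    rw [norm_mul]
    have e : √(2 * |-2 * Real.pi * x * ξ|) = √(4 * Real.pi * ξ / 2 ^ j) * √|2 ^ j * x| := by
      rw [← Real.sqrt_mul (by positivity)]
      congr 1
      simp only [abs_mul, abs_neg, abs_of_pos hpi, abs_of_nonneg hξ, abs_of_pos hL, Nat.abs_ofNat]
      field_simp
      ring
    calc _ ≤ √(2 * |-2 * Real.pi * x * ξ|) * (√(2 ^ j) * f (2 ^ j * x)) := by
          gcongr
          · exact norm_exp_sub_one_le_sqrt _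
          · exact h.bound j x
      _ = _ := by rw [e]; ring
  rw [integral_const_mul, integral_const_mul, Measure.integral_comp_mul_left (fun y => √|y| * f y),
    abs_of_pos (by positivity), smul_eq_mul] at h2
  rw [← mul_sub, abs_mul, abs_of_pos hs]
  calc _ ≤ √(2 ^ j) * ‖𝓕 (ψ j) ξ - 𝓕 (ψ j) 0‖ := by gcongr; exact abs_norm_sub_norm_le _ _
    _ ≤ √(2 ^ j) * (√(4 * Real.pi * ξ / 2 ^ j) * (√(2 ^ j) * ((2 ^ j)⁻¹ *
        ∫ y, √|y| * f y))) := by gcongr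
    _ = _ := by
      have hss : √((2 : ℝ) ^ j) ^ 2 = 2 ^ j := Real.sq_sqrt hL.le
      rw [mul_div_assoc, Real.sqrt_mul (by positivity)]
      have : √((2 : ℝ) ^ j) * (√(4 * Real.pi) * √(ξ / 2 ^ j) * (√(2 ^ j) * ((2 ^ j)⁻¹ *
        ∫ y, √|y| * f y))) = (√((2 : ℝ) ^ j) ^ 2 * (2 ^ j)⁻¹) *
          (√(4 * Real.pi) * √(ξ / 2 ^ j) * ∫ y, √|y| * f y) := by ring
      rw [this, hss, mul_inv_cancel₀ hL.ne']
      ring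

/-- The norms of the wavelets of a Parseval frame do not all tend to zero. -/
theorem exists_frequently_le_norm (hψ : ∀ j, MemLp (ψ j) 2 volume) {φ : UnitAddCircle → ℂ}
    {g : ℕ → UnitAddCircle → ℂ}
    (hP : IsParsevalFrameOfFunctions AddCircle.haarAddCircle (periodicSystem φ g))
    (hg : ∀ j, ∀ᵐ x : ℝ, g j (x : UnitAddCircle) = ∑' n : ℤ, ψ j (x - n)) :
    ∃ c : ℝ, 0 < c ∧ ∃ᶠ j in atTop, c ≤ ‖(hψ j).toLp (ψ j)‖ := by
  by_contra! hcon
  have hz : Tendsto (fun j => ‖(hψ j).toLp (ψ j)‖) atTop (𝓝 0) := by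
    rw [Metric.tendsto_nhds]
    intro c hc
    filter_upwards [hcon c hc] with j hj
    simpa using hj
  have hc : ∀ (n : ℤ), HasSum (fun j : ℕ => (√(2 ^ j) * ‖𝓕 (ψ j) n‖) ^ 2)
      (1 - ‖fourierCoeff φ n‖ ^ 2) := fun n => by
    refine (hP.hasSum_fourierCoeff_sq n).congr_fun fun j => ?_
    rw [fourierCoeff_eq_fourier_of_periodize (hg j) (h.integrable_apply j), mul_pow,
      Real.sq_sqrt (by positivity)]
  have hc' : ∀ m : ℕ, HasSum (fun j : ℕ => (√(2 ^ j) * ‖𝓕 (ψ j) (2 ^ m)‖) ^ 2)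
      (1 - ‖fourierCoeff φ (2 ^ m)‖ ^ 2) := fun m => by
    simpa using hc (2 ^ m)
  -- Frequency zero supplies the square summability of the values at the origin.
  have h0 := (hc 0).summable
  rw [Int.cast_zero] at h0
  have hlim := tendsto_tsum_sq_dyadic (a := fun j m => √(2 ^ j) * ‖𝓕 (ψ j) (2 ^ m)‖)
    (a₀ := fun j => √(2 ^ j) * ‖𝓕 (ψ j) 0‖) (fun j m => by positivity)
    (fun j m => by gcongr; exact norm_fourier_le_integral _ _)
    (fun j => by
      rw [abs_of_nonneg (by positivity)]; gcongr; exact norm_fourier_le_integral _ _)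
    (h.tendsto_sqrt_mul_integral_norm hψ hz)
    (fun j m => h.sqrt_mul_norm_fourier_le j (by positivity))
    (fun j m => h.abs_sqrt_mul_norm_fourier_sub_le j (by positivity)) h0
    (fun m => (hc' m).summable)
  simp only [(hc' _).tsum_eq] at hlim
  have hφ : Tendsto (fun m : ℕ => ‖fourierCoeff φ (2 ^ m)‖ ^ 2) atTop (𝓝 0) := by
    have hinj : Function.Injective fun m : ℕ => (2 : ℤ) ^ m :=
      pow_right_injective₀ (by norm_num) (by norm_num)
    have := (tendsto_fourierCoeff_cofinite (hP.1 (Sum.inl ()))).comp hinj.tendsto_cofinite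
    rw [Nat.cofinite_eq_atTop] at this
    exact this
  -- The two null sequences add up to the constant 1, a contradiction.
  have h1 := hlim.add hφ
  simp only [sub_add_cancel, add_zero] at h1
  exact one_ne_zero (tendsto_nhds_unique tendsto_const_nhds h1)

end IsDominatedFamily

/-! ### Conclusion -/

theorem isDominatedFamily_of_rescale {ψ : ℕ → ℝ → ℂ} {f f₁ : ℝ → ℝ} {ε : ℝ} (hε : 0 < ε)
    (hAC : ∀ j, LocallyAC (ψ j)) (hf : MemLp f 2 volume) (hf₁ : MemLp f₁ 2 volume)
    (hbound : ∀ j, ∀ x, ‖rescale j (ψ j) x‖ ≤ f x)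
    (hbound₁ : ∀ j, ∀ᵐ x, ‖deriv (rescale j (ψ j)) x‖ ≤ f₁ x)
    (hfO : f =O[cocompact ℝ] fun x => |x| ^ (-(3 / 2) - ε))
    (hf₁O : f₁ =O[cocompact ℝ] fun x => |x| ^ (-1 - ε)) : IsDominatedFamily ψ f f₁ ε where
  pos := hε
  ac := hAC
  memLp := hf
  memLp₁ := hf₁
  bound j := norm_le_of_norm_rescale_le (hbound j)
  bound₁ j := ae_norm_deriv_le_of_rescale (hbound₁ j)
  isBigO := by simpa only [neg_add'] using hfO
  isBigO₁ := by simpa only [neg_add'] using hf₁O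

theorem eventually_iff_forall_ultrafilter {ι : Type*} {l : Filter ι} {p : ι → Prop} :
    (∀ᶠ j in l, p j) ↔ ∀ U : Ultrafilter ι, ↑U ≤ l → ∀ᶠ j in U, p j :=
  Filter.mem_iff_ultrafilter

theorem mainTheorem2
    (φN : ℝ → ℂ) (ψN : ℕ → ℝ → ℂ)
    (φP : UnitAddCircle → ℂ) (ψP : ℕ → UnitAddCircle → ℂ)
    (hψN : ∀ j, MemLp (ψN j) 2 volume)
    (hN : IsParsevalFrameOfFunctions volume (nonstationarySystem φN ψN))
    (hP : IsParsevalFrameOfFunctions AddCircle.haarAddCircle (periodicSystem φP ψP))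
    (hper : ∀ j, ∀ᵐ x : ℝ, ψP j (x : UnitAddCircle) = ∑' n : ℤ, ψN j (x - n))
    (hAC : ∀ j, LocallyAC (ψN j))
    (f f₁ : ℝ → ℝ) (hf : MemLp f 2 volume) (hf₁ : MemLp f₁ 2 volume)
    (hfAC : LocallyAC f)
    (hbound : ∀ j, ∀ x, ‖rescale j (ψN j) x‖ ≤ f x)
    (hbound₁ : ∀ j, ∀ᵐ x, ‖deriv (rescale j (ψN j)) x‖ ≤ f₁ x)
    (ε : ℝ) (hε : 0 < ε)
    (hfO : f =O[cocompact ℝ] fun x => |x| ^ (-(3 / 2) - ε))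
    (hf₁O : f₁ =O[cocompact ℝ] fun x => |x| ^ (-1 - ε)) :
    -- without any further assumption: if both limits exist, they are equal
    (∀ L L' : ℝ≥0∞,
      Tendsto (fun j => breitenbergerUC (ψP j)) atTop (𝓝 L) →
      Tendsto (fun j => heisenbergUC (ψN j) (hψN j)) atTop (𝓝 L') →
      L = L') ∧
    -- if the norms do not degenerate, the constants are asymptotically equal, and
    -- either limit exists as soon as the other one does
    ((∃ c : ℝ, 0 < c ∧ ∀ᶠ j in atTop, c ≤ ‖(hψN j).toLp (ψN j)‖) →
      (∀ᶠ j in atTop, breitenbergerUC (ψP j) ≠ ∞ ∧ heisenbergUC (ψN j) (hψN j) ≠ ∞) ∧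
      Tendsto (fun j => (breitenbergerUC (ψP j)).toReal -
        (heisenbergUC (ψN j) (hψN j)).toReal) atTop (𝓝 0) ∧
      ∀ L : ℝ≥0∞,
        Tendsto (fun j => breitenbergerUC (ψP j)) atTop (𝓝 L) ↔
        Tendsto (fun j => heisenbergUC (ψN j) (hψN j)) atTop (𝓝 L)) := by

  have h := isDominatedFamily_of_rescale hε hAC hf hf₁ hbound hbound₁ hfO hf₁O
  refine ⟨fun L L' hL hL' => ?_, fun ⟨c, hc, hnorm⟩ => ?_⟩
  · obtain ⟨c, hc, hfreq⟩ := h.exists_frequently_le_norm hψN hP hper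
    have hne : (atTop ⊓ 𝓟 {j | c ≤ ‖(hψN j).toLp (ψN j)‖}).NeBot := frequently_mem_iff_neBot.1 hfreq
    -- An ultrafilter finer than `atTop` that contains the infinite set of indices with norm at
    -- least c: the assumed limits persist along it and `exists_common_limit` applies.
    set U := Ultrafilter.of (atTop ⊓ 𝓟 {j | c ≤ ‖(hψN j).toLp (ψN j)‖})
    have hU : ↑U ≤ atTop ⊓ 𝓟 {j | c ≤ ‖(hψN j).toLp (ψN j)‖} := Ultrafilter.of_le _
    obtain ⟨G, -, h1, h2⟩ := h.exists_common_limit hψN hper U (hU.trans inf_le_left) hc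
      (le_principal_iff.1 (hU.trans inf_le_right))
    have hU' := hU.trans inf_le_left
    exact (tendsto_nhds_unique (hL.mono_left hU') h1).trans
      (tendsto_nhds_unique (hL'.mono_left hU') h2).symm
  -- Under the liminf condition every ultrafilter finer than `atTop` is nondegenerate. Its limit G
  -- may depend on the ultrafilter, but is always finite and shared by both constants.
  · have key := fun (U : Ultrafilter ℕ) (hU : ↑U ≤ (atTop : Filter ℕ)) =>
      h.exists_common_limit hψN hper U hU hc (hU hnorm)
    refine ⟨eventually_iff_forall_ultrafilter.2 fun U hU => ?_,
      (tendsto_iff_ultrafilter _ _ _).2 fun U hU => ?_, fun L => ⟨fun hL => ?_, fun hL => ?_⟩⟩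
    · obtain ⟨G, hG, h1, h2⟩ := key U hU
      exact (h1.eventually_ne hG).and (h2.eventually_ne hG)
    · obtain ⟨G, hG, h1, h2⟩ := key U hU
      have := ((ENNReal.tendsto_toReal hG).comp h1).sub ((ENNReal.tendsto_toReal hG).comp h2)
      rw [sub_self] at this
      exact this
    · refine (tendsto_iff_ultrafilter _ _ _).2 fun U hU => ?_
      obtain ⟨G, -, h1, h2⟩ := key U hU
      rw [tendsto_nhds_unique (hL.mono_left hU) h1]
      exact h2
    · refine (tendsto_iff_ultrafilter _ _ _).2 fun U hU => ?_
      obtain ⟨G, -, h1, h2⟩ := key U hU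
      rw [tendsto_nhds_unique (hL.mono_left hU) h2]
      exact h1
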